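/- Let $X$ be a Hausdorff, locally compact, connected and locally connected space. Conventions: the empty set counts as connected; a set is bounded if its closure is compact; "component" means connected component. A set $A\subseteq X$ is semisolid if $A$ is connected and $X\setminus A$ has only finitely many components. If $X$ is noncompact, $A$ is solid if $A$ is connected and all components of $X\setminus A$ are unbounded; if $X$ is compact, $A$ is solid if $A$ and $X\setminus A$ are connected. Let $\mathscr A_s^*(X)$ be the collection of all compact solid sets and all bounded open solid sets. A solid-set function is a function $\lambda:\mathscr A_s^*(X)\to[0,\infty)$ such that (s1) $\sum_{i=1}^n\lambda(C_i)\le\lambda(C)$ whenever $C_1,\dots,C_n$ are disjoint compact solid subsets of a compact solid set $C$; (s2) $\lambda(U)=\sup\{\lambda(K): K\subseteq U,\ K \text{ compact solid}\}$ for every bounded open solid $U$; (s3) $\lambda(K)=\inf\{\lambda(U): K\subseteq U,\ U\text{ bounded open solid}\}$ for every compact solid $K$; (s4) $\lambda(A)=\sum_{i=1}^n\lambda(A_i)$ whenever $A\in\mathscr A_s^*(X)$ is the disjoint union of $A_1,\dots,A_n\in\mathscr A_s^*(X)$. A topological measure on $X$ is a function $\mu$, not identically $\infty$, from the collection of all open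 and all closed subsets of $X$ to $[0,\infty]$ such that (TM1) $\mu(A\sqcup B)=\mu(A)+\mu(B)$ whenever $A$, $B$ are disjoint and each of $A$, $B$, $A\sqcup B$ is compact or open; (TM2) $\mu(U)=\sup\{\mu(K):K\subseteq U,\ K\text{ compact}\}$ for every open $U$; (TM3) $\mu(F)=\inf\{\mu(U):F\subseteq U,\ U\text{ open}\}$ for every closed $F$. It is compact-finite if $\mu(K)<\infty$ for every compact $K$. Theorem. Every solid-set function $\lambda$ on $X$ extends uniquely to a compact-finite topological measure $\mu$ on $X$; in fact $\mu$ is the only topological measure on $X$ that agrees with $\lambda$ on $\mathscr A_s^*(X)$. The extension is given by the following three steps. 1. For $A$ compact semisolid, bounded open semisolid, or compact connected, let $\{B_i\}_{i\in I}$ be the bounded components of $X\setminus A$ and let $\widetilde A=A\sqcup\bigsqcup_{i\in I}B_i$ be the solid hull of $A$. Then $\sum_{i\in I}\lambda(B_i)\le\lambda(\widetilde A)$ and $\mu(A)=\lambda_1(A):=\lambda(\widetilde A)-\sum_{i\in I}\lambda(B_i)$. 2. For $K=\bigsqcup_{i=1}^n C_i$ with $C_1,\dots,C_n$ disjoint compact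 connected sets, $\mu(K)=\lambda_2(K):=\sum_{i=1}^n\lambda_1(C_i)$, and this sum depends only on $K$. 3. For every open $U$, $\mu(U)=\sup\{\lambda_2(K): K\subseteq U,\ K \text{ a finite union of disjoint compact connected sets}\}$, and for every closed $F$, $\mu(F)=\inf\{\mu(U): F\subseteq U,\ U\text{ open}\}$. -/

import Mathlib

open scoped NNReal ENNReal

section SolidSets

variable {X : Type*} [TopologicalSpace X]

/-- A set is bounded if its closure is compact. -/
def IsBoundedSet (A : Set X) : Prop := IsCompact (closure A)

/-- The family of all (nonempty) connected components of the set `S`. -/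
def componentsOf (S : Set X) : Set (Set X) :=
  {B | ∃ x ∈ S, B = connectedComponentIn S x}

/-- The family of all bounded connected components of the set `S`. -/
def boundedComponentsOf (S : Set X) : Set (Set X) :=
  {B | B ∈ componentsOf S ∧ IsBoundedSet B}

/-- Solid sets. The empty set counts as connected. If `X` is compact, `A` is solid if `A` and
its complement are connected; if `X` is noncompact, `A` is solid if `A` is connected and its
complement has only unbounded components. -/
def IsSolid (A : Set X) : Prop :=
  IsPreconnected A ∧
    (CompactSpace X → IsPreconnected Aᶜ) ∧
    (¬ CompactSpace X → ∀ B ∈ componentsOf Aᶜ, ¬ IsBoundedSet B)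

/-- Semisolid sets: connected sets whose complement has finitely many components. -/
def IsSemisolid (A : Set X) : Prop :=
  IsPreconnected A ∧ (componentsOf Aᶜ).Finite

/-- Compact solid sets. -/
def IsCompactSolid (A : Set X) : Prop := IsCompact A ∧ IsSolid A

/-- Bounded open solid sets. -/
def IsBddOpenSolid (A : Set X) : Prop := IsOpen A ∧ IsBoundedSet A ∧ IsSolid A

/-- The domain of a solid-set function: bounded open solid sets and compact solid sets. -/
def IsBddSolid (A : Set X) : Prop := IsBddOpenSolid A ∨ IsCompactSolid A

/-- Compact semisolid sets, bounded open semisolid sets and compact connected sets. -/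
def IsBddSemisolidOrCompactConnected (A : Set X) : Prop :=
  (IsCompact A ∧ IsSemisolid A) ∨ (IsOpen A ∧ IsBoundedSet A ∧ IsSemisolid A) ∨
    (IsCompact A ∧ IsPreconnected A)

/-- Finite unions of pairwise disjoint compact connected sets. -/
def IsKZero (K : Set X) : Prop :=
  ∃ (n : ℕ) (C : Fin n → Set X), (∀ i, IsCompact (C i) ∧ IsPreconnected (C i)) ∧
    Pairwise (Function.onFun Disjoint C) ∧ K = ⋃ i, C i

/-- The solid hull of `A`: the union of `A` and all bounded components of its complement. -/
def solidHull (A : Set X) : Set X := A ∪ ⋃₀ boundedComponentsOf Aᶜ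

/-- Solid-set functions. Only the values of `lam` on bounded open solid sets and on compact
solid sets matter. The empty set belongs to the domain. -/
structure IsSolidSetFunction (lam : Set X → ℝ≥0) : Prop where
  superadd : ∀ (n : ℕ) (C : Fin n → Set X) (D : Set X), (∀ i, IsCompactSolid (C i)) →
    IsCompactSolid D → Pairwise (Function.onFun Disjoint C) → (⋃ i, C i) ⊆ D →
    ∑ i, lam (C i) ≤ lam D
  inner_regular : ∀ U : Set X, IsBddOpenSolid U →
    IsLUB {r | ∃ K : Set X, IsCompactSolid K ∧ K ⊆ U ∧ lam K = r} (lam U)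
  outer_regular : ∀ K : Set X, IsCompactSolid K →
    IsGLB {r | ∃ U : Set X, IsBddOpenSolid U ∧ K ⊆ U ∧ lam U = r} (lam K)
  partition : ∀ (n : ℕ) (B : Fin n → Set X) (A : Set X), (∀ i, IsBddSolid (B i)) →
    IsBddSolid A → Pairwise (Function.onFun Disjoint B) → A = ⋃ i, B i →
    lam A = ∑ i, lam (B i)

/-- Topological measures: set functions on the open sets and the closed sets, with values in
`[0, ∞]` and not identically `∞`. Only the values of `μ` on open and on closed sets matter. -/
structure IsTopologicalMeasure (μ : Set X → ℝ≥0∞) : Prop where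
  not_identically_top : ∃ A : Set X, (IsOpen A ∨ IsClosed A) ∧ μ A ≠ ∞
  add : ∀ A B : Set X, (IsCompact A ∨ IsOpen A) → (IsCompact B ∨ IsOpen B) →
    (IsCompact (A ∪ B) ∨ IsOpen (A ∪ B)) → Disjoint A B → μ (A ∪ B) = μ A + μ B
  inner_regular : ∀ U : Set X, IsOpen U →
    μ U = ⨆ K ∈ {K : Set X | IsCompact K ∧ K ⊆ U}, μ K
  outer_regular : ∀ F : Set X, IsClosed F →
    μ F = ⨅ U ∈ {U : Set X | IsOpen U ∧ F ⊆ U}, μ U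

/-- Compact-finite set functions. -/
def IsCompactFinite (μ : Set X → ℝ≥0∞) : Prop := ∀ K : Set X, IsCompact K → μ K < ∞

/-- `μ` extends `lam`, i.e. both agree on bounded open solid and on compact solid sets. -/
def Extends (μ : Set X → ℝ≥0∞) (lam : Set X → ℝ≥0) : Prop :=
  ∀ A : Set X, IsBddSolid A → μ A = (lam A : ℝ≥0∞)

/-- The (possibly infinite) sum of `lam B` over all bounded components `B` of the complement
of `A`. -/
noncomputable def holesSum (lam : Set X → ℝ≥0) (A : Set X) : ℝ≥0∞ :=
  ∑' B : boundedComponentsOf Aᶜ, (lam (B : Set X) : ℝ≥0∞)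

/-- First step of the extension: the value on the solid hull minus the values on the bounded
components of the complement. -/
noncomputable def lambdaOne (lam : Set X → ℝ≥0) (A : Set X) : ℝ≥0∞ :=
  (lam (solidHull A) : ℝ≥0∞) - holesSum lam A

/-- Second step of the extension: the sum of `lambdaOne` over the connected components of `K`.
It is used for finite disjoint unions of compact connected sets only. -/
noncomputable def lambdaTwo (lam : Set X → ℝ≥0) (K : Set X) : ℝ≥0∞ :=
  ∑' B : componentsOf K, lambdaOne lam (B : Set X)

end SolidSets

/-! ### Components of sets in locally connected and locally compact spaces. -/

section ComponentFamilies

open Set Topology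

variable {X : Type*} [TopologicalSpace X]

/-! Uniqueness shows what the extension has to be. A bounded component of the complement of a
nonempty compact connected (or bounded open semisolid) set A is itself bounded and solid. So the
hull of A is the disjoint union of A and solid holes, and additivity forces the value on A to be
`lam` of the hull minus the values of the holes (`eq_lambdaOne`). Finite unions of disjoint compact
connected sets are cofinal among the compact subsets of an open set, so inner regularity then fixes
the values on open sets (`eq_innerValue`) and outer regularity those on closed sets.

For existence these formulas become definitions, `innerValue` and `solidExtension`. The
combinatorial core is `sum_lambdaOne_of_card_le`: inside a bounded solid set E, `lambdaOne` is
superadditive on finite disjoint families, and additive if the family partitions E. The induction is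
on the number of nonsolid members. One such member A is chosen; its hull replaces A together with
everything in its holes, each hole is a solid set containing its own subfamily, and
`lambdaOne_add_tsum_holesIn` glues the estimates. Hulls are taken relative to E, so that compact and
noncompact spaces are treated alike.

Additivity on two open or two compact sets is a matter of separation. The mixed case rests on
`innerValue_le_add_sdiff`, which bounds the value of an open set V by those of W and V \ K when K ⊆
W ⊆ V with K compact and W open. Here `exists_separation` supplies a compact Q between K and W and a
closed Z away from Q and from a given compact family in V, such that Q, Z and the gap between them
have finitely many components. The components of the complement of Z are then bounded open semisolid
sets, partitioned by components of Q and of the gap, and additivity of `lambdaOne` splits the sum.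
-/

theorem nonempty_of_mem_componentsOf {S B : Set X} (hB : B ∈ componentsOf S) : B.Nonempty := by
  obtain ⟨x, hx, rfl⟩ := hB
  exact ⟨x, mem_connectedComponentIn hx⟩

theorem isPreconnected_of_mem_componentsOf {S B : Set X} (hB : B ∈ componentsOf S) :
    IsPreconnected B := by
  obtain ⟨x, -, rfl⟩ := hB
  exact isPreconnected_connectedComponentIn

theorem subset_of_mem_componentsOf {S B : Set X} (hB : B ∈ componentsOf S) : B ⊆ S := by
  obtain ⟨x, -, rfl⟩ := hB
  exact connectedComponentIn_subset _ _

theorem subset_component_of_inter_nonempty {S B C : Set X} (hB : B ∈ componentsOf S)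
    (hC : IsPreconnected C) (hCS : C ⊆ S) (h : (C ∩ B).Nonempty) : C ⊆ B := by
  obtain ⟨x, -, rfl⟩ := hB
  obtain ⟨y, hyC, hyB⟩ := h
  rw [connectedComponentIn_eq hyB]
  exact hC.subset_connectedComponentIn hyC hCS

theorem eq_of_mem_componentsOf {S A B : Set X} (hA : A ∈ componentsOf S) (hB : B ∈ componentsOf S)
    (h : (A ∩ B).Nonempty) : A = B :=
  (subset_component_of_inter_nonempty hB (isPreconnected_of_mem_componentsOf hA)
    (subset_of_mem_componentsOf hA) h).antisymm
  (subset_component_of_inter_nonempty hA (isPreconnected_of_mem_componentsOf hB)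
    (subset_of_mem_componentsOf hB) (by rwa [inter_comm]))

theorem pairwiseDisjoint_componentsOf (S : Set X) : (componentsOf S).PairwiseDisjoint id :=
  fun _ hA _ hB hne => disjoint_iff_inter_eq_empty.2 <| not_nonempty_iff_eq_empty.1 fun h =>
    hne (eq_of_mem_componentsOf hA hB h)

theorem exists_mem_componentsOf_mem {S : Set X} {x : X} (hx : x ∈ S) :
    ∃ B ∈ componentsOf S, x ∈ B :=
  ⟨_, ⟨x, hx, rfl⟩, mem_connectedComponentIn hx⟩

theorem sUnion_componentsOf (S : Set X) : ⋃₀ componentsOf S = S :=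
  (sUnion_subset fun _ h => subset_of_mem_componentsOf h).antisymm
    fun _ hx => mem_sUnion.2 (exists_mem_componentsOf_mem hx)

theorem exists_component_superset {S C : Set X} (hC : IsPreconnected C) (hCS : C ⊆ S)
    (hne : C.Nonempty) : ∃ B ∈ componentsOf S, C ⊆ B := by
  obtain ⟨x, hx⟩ := hne
  obtain ⟨B, hB, hxB⟩ := exists_mem_componentsOf_mem (hCS hx)
  exact ⟨B, hB, subset_component_of_inter_nonempty hB hC hCS ⟨x, hx, hxB⟩⟩

/-- A family of nonempty connected sets that absorbs every connected subset of its union that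
meets it is the family of components of its union. -/
theorem componentsOf_sUnion_eq {F : Set (Set X)} (hconn : ∀ A ∈ F, IsPreconnected A)
    (hne : ∀ A ∈ F, A.Nonempty)
    (habs : ∀ A ∈ F, ∀ C, IsPreconnected C → C ⊆ ⋃₀ F → (C ∩ A).Nonempty → C ⊆ A) :
    componentsOf (⋃₀ F) = F := by
  have key : ∀ A ∈ F, ∀ x ∈ A, connectedComponentIn (⋃₀ F) x = A := fun A hA x hx =>
    (habs A hA _ isPreconnected_connectedComponentIn (connectedComponentIn_subset _ _)
      ⟨x, mem_connectedComponentIn (mem_sUnion_of_mem hx hA), hx⟩).antisymm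
    ((hconn A hA).subset_connectedComponentIn hx (subset_sUnion_of_mem hA))
  ext B
  constructor
  · rintro ⟨x, ⟨A, hA, hx⟩, rfl⟩
    rwa [key A hA x hx]
  · intro hB
    obtain ⟨x, hx⟩ := hne B hB
    exact ⟨x, mem_sUnion_of_mem hx hB, (key B hB x hx).symm⟩

theorem componentsOf_sUnion_of_subset {S : Set X} {ℬ : Set (Set X)} (h : ℬ ⊆ componentsOf S) :
    componentsOf (⋃₀ ℬ) = ℬ :=
  componentsOf_sUnion_eq (fun _ hA => isPreconnected_of_mem_componentsOf (h hA))
    (fun _ hA => nonempty_of_mem_componentsOf (h hA)) fun _ hA _ hC hCS hne =>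
      subset_component_of_inter_nonempty (h hA) hC
        (hCS.trans (sUnion_subset fun _ hB => subset_of_mem_componentsOf (h hB))) hne

theorem isClosed_sUnion_of_finite {F : Set (Set X)} (hfin : F.Finite)
    (hcl : ∀ A ∈ F, IsClosed A) : IsClosed (⋃₀ F) := by
  rw [sUnion_eq_biUnion]
  exact hfin.isClosed_biUnion hcl

theorem componentsOf_sUnion_of_isClosed {F : Set (Set X)} (hfin : F.Finite)
    (hcl : ∀ A ∈ F, IsClosed A) (hconn : ∀ A ∈ F, IsPreconnected A) (hne : ∀ A ∈ F, A.Nonempty)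
    (hd : F.PairwiseDisjoint id) : componentsOf (⋃₀ F) = F := by
  refine componentsOf_sUnion_eq hconn hne fun A hA C hC hCF hCA => ?_
  have hcl' : IsClosed (⋃₀ (F \ {A})) :=
    isClosed_sUnion_of_finite (hfin.subset sdiff_subset) fun B hB => hcl B hB.1
  have hdis : Disjoint A (⋃₀ (F \ {A})) :=
    disjoint_sUnion_right.2 fun B hB => hd hA hB.1 (Ne.symm hB.2)
  have hsub : C ⊆ A ∪ ⋃₀ (F \ {A}) := by
    intro x hx
    obtain ⟨B, hB, hxB⟩ := hCF hx
    by_cases h : B = A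
    · exact Or.inl (h ▸ hxB)
    · exact Or.inr ⟨B, ⟨hB, h⟩, hxB⟩
  rcases isPreconnected_iff_subset_of_disjoint_closed.1 hC A _ (hcl A hA) hcl' hsub
    (by rw [hdis.inter_eq, inter_empty]) with h | h
  · exact h
  · obtain ⟨x, hxC, hxA⟩ := hCA
    exact (disjoint_left.1 hdis hxA (h hxC)).elim

theorem finite_componentsOf_sUnion {F : Set (Set X)} (hfin : F.Finite)
    (hconn : ∀ A ∈ F, IsPreconnected A) : (componentsOf (⋃₀ F)).Finite := by
  classical
  -- Each nonempty member is sent to the component that contains it, and every component arises this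
  -- way. The value `∅` at an empty member is never used.
  refine (hfin.image fun A => if h : A.Nonempty then connectedComponentIn (⋃₀ F) h.some
    else ∅).subset ?_
  rintro _ ⟨x, ⟨A, hA, hx⟩, rfl⟩
  refine ⟨A, hA, ?_⟩
  have hne : A.Nonempty := ⟨x, hx⟩
  simp only [hne, dif_pos]
  exact (connectedComponentIn_eq ((hconn A hA).subset_connectedComponentIn hx
    (subset_sUnion_of_mem hA) hne.some_mem)).symm

theorem finite_componentsOf_union {S T : Set X} (hS : (componentsOf S).Finite)
    (hT : (componentsOf T).Finite) : (componentsOf (S ∪ T)).Finite := by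
  have : S ∪ T = ⋃₀ (componentsOf S ∪ componentsOf T) := by
    rw [sUnion_union, sUnion_componentsOf, sUnion_componentsOf]
  rw [this]
  refine finite_componentsOf_sUnion (hS.union hT) ?_
  rintro A (hA | hA) <;> exact isPreconnected_of_mem_componentsOf hA

theorem isOpen_of_mem_componentsOf [LocallyConnectedSpace X] {S B : Set X} (hS : IsOpen S)
    (hB : B ∈ componentsOf S) : IsOpen B := by
  obtain ⟨x, -, rfl⟩ := hB
  exact hS.connectedComponentIn

/-- A set between B and its closure is connected, so maximality of the component applies. Closedness
of components of closed sets and the clopen arguments below come from this. -/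
theorem closure_inter_subset_of_mem_componentsOf {S B : Set X} (hB : B ∈ componentsOf S) :
    closure B ∩ S ⊆ B := by
  obtain ⟨x, hx⟩ := nonempty_of_mem_componentsOf hB
  exact subset_component_of_inter_nonempty hB
    ((isPreconnected_of_mem_componentsOf hB).subset_closure
      (subset_inter subset_closure (subset_of_mem_componentsOf hB)) inter_subset_left)
    inter_subset_right ⟨x, ⟨subset_closure hx, subset_of_mem_componentsOf hB hx⟩, hx⟩

theorem isClosed_of_mem_componentsOf {S B : Set X} (hS : IsClosed S) (hB : B ∈ componentsOf S) :
    IsClosed B := by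
  refine isClosed_of_closure_subset fun x hx => closure_inter_subset_of_mem_componentsOf hB
    ⟨hx, closure_minimal (subset_of_mem_componentsOf hB) hS hx⟩

/-- Only finitely many components of an open set meet a given compact subset of it. -/
theorem finite_componentsOf_meeting [LocallyConnectedSpace X] {S F : Set X} (hS : IsOpen S)
    (hF : IsCompact F) (hFS : F ⊆ S) : {B ∈ componentsOf S | (B ∩ F).Nonempty}.Finite := by
  obtain ⟨t, ht, htfin, hcov⟩ := hF.elim_finite_subcover_image (c := id) (b := componentsOf S)
    (fun B hB => isOpen_of_mem_componentsOf hS hB)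
    (by simpa only [id, ← sUnion_eq_biUnion, sUnion_componentsOf] using hFS)
  refine htfin.subset ?_
  rintro B ⟨hB, x, hxB, hxF⟩
  obtain ⟨B', hB', hx'⟩ := mem_iUnion₂.1 (hcov hxF)
  rwa [eq_of_mem_componentsOf hB (ht hB') ⟨x, hxB, hx'⟩]

theorem compl_union_sUnion_componentsOf {A : Set X} {ℬ : Set (Set X)}
    (h : ℬ ⊆ componentsOf Aᶜ) : (A ∪ ⋃₀ ℬ)ᶜ = ⋃₀ (componentsOf Aᶜ \ ℬ) := by
  ext x
  constructor
  · intro hx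
    rw [mem_compl_iff, mem_union, not_or] at hx
    obtain ⟨B, hB, hxB⟩ := exists_mem_componentsOf_mem (S := Aᶜ) hx.1
    exact ⟨B, ⟨hB, fun hB' => hx.2 ⟨B, hB', hxB⟩⟩, hxB⟩
  · rintro ⟨B, ⟨hB, hBn⟩, hxB⟩ (hxA | ⟨B', hB', hxB'⟩)
    · exact subset_of_mem_componentsOf hB hxB hxA
    · exact hBn (eq_of_mem_componentsOf (h hB') hB ⟨x, hxB', hxB⟩ ▸ hB')

/-- A connected set together with connected sets each of which adheres to it is connected. -/
theorem IsPreconnected.union_sUnion_of_adherent {A : Set X} {ℬ : Set (Set X)}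
    (hA : IsPreconnected A) (hAne : A.Nonempty) (hℬ : ∀ B ∈ ℬ, IsPreconnected (A ∪ B)) :
    IsPreconnected (A ∪ ⋃₀ ℬ) := by
  obtain ⟨x, hx⟩ := hAne
  have : A ∪ ⋃₀ ℬ = ⋃₀ (insert A ((fun B => A ∪ B) '' ℬ)) := by
    ext y
    simp only [mem_union, mem_sUnion, mem_insert_iff, exists_eq_or_imp, mem_image,
      exists_exists_and_eq_and]
    constructor
    · rintro (h | ⟨B, hB, hy⟩)
      · exact Or.inl h
      · exact Or.inr ⟨B, hB, Or.inr hy⟩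
    · rintro (h | ⟨B, hB, h | hy⟩)
      · exact Or.inl h
      · exact Or.inl h
      · exact Or.inr ⟨B, hB, hy⟩
  rw [this]
  refine isPreconnected_sUnion x _ ?_ ?_
  · rintro _ (rfl | ⟨B, -, rfl⟩)
    · exact hx
    · exact Or.inl hx
  · rintro _ (rfl | ⟨B, hB, rfl⟩)
    · exact hA
    · exact hℬ B hB

theorem IsPreconnected.union_of_closure_inter {A B : Set X} (hA : IsPreconnected A)
    (hB : IsPreconnected B) (h : (closure A ∩ B).Nonempty) : IsPreconnected (A ∪ B) := by
  obtain ⟨x, hxA, hxB⟩ := h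
  have h1 : IsPreconnected (insert x A) :=
    hA.subset_closure (subset_insert _ _) (insert_subset hxA subset_closure)
  have h2 := IsPreconnected.union x (mem_insert x A) hxB h1 hB
  rwa [insert_union, insert_eq_of_mem (mem_union_right A hxB)] at h2

/-- A component of the complement of a nonempty closed set adheres to this set. -/
theorem closure_inter_nonempty_of_mem_componentsOf_compl [PreconnectedSpace X]
    [LocallyConnectedSpace X] {A B : Set X} (hA : IsClosed A) (hne : A.Nonempty)
    (hB : B ∈ componentsOf Aᶜ) : (closure B ∩ A).Nonempty := by
  by_contra h
  have hcl : closure B ⊆ B := fun x hx => closure_inter_subset_of_mem_componentsOf hB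
    ⟨hx, fun hxA => h ⟨x, hx, hxA⟩⟩
  rcases isClopen_iff.1 ⟨isClosed_of_closure_subset hcl,
    isOpen_of_mem_componentsOf hA.isOpen_compl hB⟩ with h0 | h0
  · exact (nonempty_of_mem_componentsOf hB).ne_empty h0
  · obtain ⟨x, hx⟩ := hne
    exact subset_of_mem_componentsOf hB (h0 ▸ mem_univ x) hx

/-- A component of the complement of a nonempty open set adheres to this set, if there are only
finitely many components. -/
theorem inter_closure_nonempty_of_mem_componentsOf_compl [PreconnectedSpace X]
    {A B : Set X} (hA : IsOpen A) (hne : A.Nonempty) (hfin : (componentsOf Aᶜ).Finite)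
    (hB : B ∈ componentsOf Aᶜ) : (closure A ∩ B).Nonempty := by
  by_contra h
  have hBcl := isClosed_of_mem_componentsOf hA.isClosed_compl hB
  have hcl : IsClosed (⋃₀ (componentsOf Aᶜ \ {B})) :=
    isClosed_sUnion_of_finite (hfin.subset sdiff_subset) fun C hC =>
      isClosed_of_mem_componentsOf hA.isClosed_compl hC.1
  -- If B missed the closure of A, its complement would be a finite union of closed sets, and B
  -- would be clopen. This is where finiteness of the number of components enters.
  have hBc : Bᶜ = closure A ∪ ⋃₀ (componentsOf Aᶜ \ {B}) := by
    ext x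
    constructor
    · intro hx
      by_cases hxA : x ∈ A
      · exact Or.inl (subset_closure hxA)
      · obtain ⟨C, hC, hxC⟩ := exists_mem_componentsOf_mem (S := Aᶜ) hxA
        exact Or.inr ⟨C, ⟨hC, fun h => hx (h ▸ hxC)⟩, hxC⟩
    · rintro (hx | ⟨C, ⟨hC, hCB⟩, hxC⟩) hxB
      · exact h ⟨x, hx, hxB⟩
      · exact hCB (eq_of_mem_componentsOf hC hB ⟨x, hxC, hxB⟩)
  have hop : IsOpen B := by
    rw [← isClosed_compl_iff, hBc]
    exact isClosed_closure.union hcl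
  rcases isClopen_iff.1 ⟨hBcl, hop⟩ with h0 | h0
  · exact (nonempty_of_mem_componentsOf hB).ne_empty h0
  · obtain ⟨x, hx⟩ := hne
    exact subset_of_mem_componentsOf hB (h0 ▸ mem_univ x) hx

/-- Adding to a set with finitely many components connected sets that adhere to it leaves only
finitely many components. -/
theorem finite_componentsOf_union_sUnion {Y : Set X} {ℬ : Set (Set X)}
    (hY : (componentsOf Y).Finite) (hℬ : ∀ B ∈ ℬ, IsPreconnected B)
    (hadh : ∀ B ∈ ℬ, (closure B ∩ Y).Nonempty) : (componentsOf (Y ∪ ⋃₀ ℬ)).Finite := by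
  -- Every component of Y absorbs all members of ℬ adhering to it. The results are connected,
  -- finitely many, and cover.
  have : Y ∪ ⋃₀ ℬ = ⋃₀ ((fun C => C ∪ ⋃₀ {B ∈ ℬ | (closure B ∩ C).Nonempty}) ''
      componentsOf Y) := by
    ext x
    constructor
    · rintro (hx | ⟨B, hB, hxB⟩)
      · obtain ⟨C, hC, hxC⟩ := exists_mem_componentsOf_mem hx
        exact ⟨_, ⟨C, hC, rfl⟩, Or.inl hxC⟩
      · obtain ⟨y, hyB, hyY⟩ := hadh B hB
        obtain ⟨C, hC, hyC⟩ := exists_mem_componentsOf_mem hyY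
        exact ⟨_, ⟨C, hC, rfl⟩, Or.inr ⟨B, ⟨hB, y, hyB, hyC⟩, hxB⟩⟩
    · rintro ⟨_, ⟨C, hC, rfl⟩, hx | ⟨B, hB, hxB⟩⟩
      · exact Or.inl (subset_of_mem_componentsOf hC hx)
      · exact Or.inr ⟨B, hB.1, hxB⟩
  rw [this]
  refine finite_componentsOf_sUnion (hY.image _) ?_
  rintro _ ⟨C, hC, rfl⟩
  refine (isPreconnected_of_mem_componentsOf hC).union_sUnion_of_adherent
    (nonempty_of_mem_componentsOf hC) fun B hB => ?_
  rw [union_comm]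
  exact (hℬ B hB.1).union_of_closure_inter (isPreconnected_of_mem_componentsOf hC) hB.2

/-- A connected set that misses the frontier of `N` lies in the interior or in the complement. -/
theorem IsPreconnected.subset_interior_or_subset_compl {O N : Set X} (hO : IsPreconnected O)
    (h : Disjoint O (frontier N)) : O ⊆ interior N ∨ O ⊆ (closure N)ᶜ := by
  have hsub : O ⊆ interior N ∪ (closure N)ᶜ := by
    intro x hx
    by_cases hxi : x ∈ interior N
    · exact Or.inl hxi
    · exact Or.inr fun hxc => disjoint_left.1 h hx ⟨hxc, hxi⟩
  refine isPreconnected_iff_subset_of_disjoint.1 hO _ _ isOpen_interior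
    isClosed_closure.isOpen_compl hsub ?_
  rw [eq_empty_iff_forall_notMem]
  rintro x ⟨-, hxi, hxc⟩
  exact hxc (subset_closure (interior_subset hxi))

/-- A compact subset of an open set has a compact neighbourhood with finitely many components
inside the open set. -/
theorem exists_compact_finite_componentsOf [LocallyCompactSpace X] [LocallyConnectedSpace X]
    {K U : Set X} (hK : IsCompact K) (hU : IsOpen U) (hKU : K ⊆ U) [T2Space X] :
    ∃ Q, IsCompact Q ∧ K ⊆ interior Q ∧ Q ⊆ U ∧ (componentsOf Q).Finite := by
  have hloc : ∀ x ∈ U, ∃ C, IsCompact C ∧ IsPreconnected C ∧ x ∈ interior C ∧ C ⊆ U := by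
    intro x hx
    obtain ⟨N, hN, hxN, hNU⟩ := exists_compact_subset hU hx
    refine ⟨closure (connectedComponentIn (interior N) x), ?_,
      isPreconnected_connectedComponentIn.closure, ?_, ?_⟩
    · exact hN.of_isClosed_subset isClosed_closure (closure_minimal
        ((connectedComponentIn_subset _ _).trans interior_subset) hN.isClosed)
    · exact interior_maximal subset_closure isOpen_interior.connectedComponentIn
        (mem_connectedComponentIn hxN)
    · exact (closure_minimal ((connectedComponentIn_subset _ _).trans interior_subset)
        hN.isClosed).trans hNU
  choose! C hCc hCp hCx hCU using hloc
  obtain ⟨t, ht, hcov⟩ := hK.elim_nhds_subcover (fun x => interior (C x))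
    fun x hx => isOpen_interior.mem_nhds (hCx x (hKU hx))
  refine ⟨⋃₀ (C '' (t : Set X)), ?_, ?_, ?_, ?_⟩
  · rw [sUnion_image]
    exact t.finite_toSet.isCompact_biUnion fun x hx => hCc x (hKU (ht x hx))
  · intro y hy
    obtain ⟨x, hx, hyx⟩ := mem_iUnion₂.1 (hcov hy)
    exact interior_mono (subset_sUnion_of_mem (mem_image_of_mem C hx)) hyx
  · rintro y ⟨_, ⟨x, hx, rfl⟩, hy⟩
    exact hCU x (hKU (ht x hx)) hy
  · refine finite_componentsOf_sUnion (t.finite_toSet.image C) ?_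
    rintro _ ⟨x, hx, rfl⟩
    exact hCp x (hKU (ht x hx))

/-- A compact subset of a connected open set is contained in a compact connected subset. -/
theorem exists_compact_connected_between [LocallyCompactSpace X] [LocallyConnectedSpace X]
    [T2Space X] {K U : Set X} (hK : IsCompact K) (hU : IsOpen U) (hUc : IsPreconnected U)
    (hne : U.Nonempty) (hKU : K ⊆ U) :
    ∃ C, IsCompact C ∧ IsPreconnected C ∧ C.Nonempty ∧ K ⊆ C ∧ C ⊆ U := by
  obtain ⟨x₀, hx₀⟩ := hne
  have hjoin : ∀ x ∈ U, ∃ C, IsCompact C ∧ IsPreconnected C ∧ x₀ ∈ C ∧ x ∈ C ∧ C ⊆ U := by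
    intro x hx
    -- Lying in a common compact connected subset of U is a transitive and symmetric relation that
    -- holds locally, hence it holds throughout the connected set U.
    refine hUc.induction₂ (fun a b => ∃ C, IsCompact C ∧ IsPreconnected C ∧ a ∈ C ∧ b ∈ C ∧ C ⊆ U)
      ?_ ?_ ?_ hx₀ hx
    · intro a ha
      obtain ⟨Q, hQ, haQ, hQU, -⟩ := exists_compact_finite_componentsOf isCompact_singleton hU
        (singleton_subset_iff.2 ha)
      have haQ' : a ∈ interior Q := haQ rfl
      refine mem_nhdsWithin_of_mem_nhds ?_
      filter_upwards [(isOpen_interior.connectedComponentIn (F := interior Q)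
        (x := a)).mem_nhds (mem_connectedComponentIn haQ')] with b hb
      have hcl : closure (connectedComponentIn (interior Q) a) ⊆ Q :=
        closure_minimal ((connectedComponentIn_subset _ _).trans interior_subset) hQ.isClosed
      exact ⟨_, hQ.of_isClosed_subset isClosed_closure hcl,
        isPreconnected_connectedComponentIn.closure,
        subset_closure (mem_connectedComponentIn haQ'), subset_closure hb, hcl.trans hQU⟩
    · rintro a b c - - - ⟨C, hC, hCp, haC, hbC, hCU⟩ ⟨D, hD, hDp, hbD, hcD, hDU⟩
      exact ⟨C ∪ D, hC.union hD, hCp.union b hbC hbD hDp, Or.inl haC, Or.inr hcD,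
        union_subset hCU hDU⟩
    · rintro a b - - ⟨C, hC, hCp, haC, hbC, hCU⟩
      exact ⟨C, hC, hCp, hbC, haC, hCU⟩
  choose! D hDc hDp hDx₀ hDx hDU using hjoin
  obtain ⟨Q, hQ, hKQ, hQU, hQfin⟩ := exists_compact_finite_componentsOf hK hU hKU
  have : Nonempty X := ⟨x₀⟩
  have hrep : ∀ B ∈ componentsOf Q, ∃ x ∈ U, x ∈ B := fun B hB => by
    obtain ⟨x, hx⟩ := nonempty_of_mem_componentsOf hB
    exact ⟨x, hQU (subset_of_mem_componentsOf hB hx), hx⟩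
  choose! r hrU hrB using hrep
  have hcomp : ∀ B ∈ componentsOf Q, IsCompact B := fun B hB =>
    hQ.of_isClosed_subset (isClosed_of_mem_componentsOf hQ.isClosed hB)
      (subset_of_mem_componentsOf hB)
  -- Each of the finitely many components B of Q is tied to the base point by a compact connected
  -- set `D (r B)` through a point of B.
  refine ⟨{x₀} ∪ ⋃₀ ((fun B => B ∪ D (r B)) '' componentsOf Q), ?_, ?_, ⟨x₀, Or.inl rfl⟩, ?_, ?_⟩
  · refine isCompact_singleton.union ?_
    rw [sUnion_image]
    exact hQfin.isCompact_biUnion fun B hB => (hcomp B hB).union (hDc _ (hrU B hB))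
  · refine isPreconnected_singleton.union_sUnion_of_adherent (singleton_nonempty _) ?_
    rintro _ ⟨B, hB, rfl⟩
    rw [union_eq_self_of_subset_left
      (singleton_subset_iff.2 (mem_union_right B (hDx₀ _ (hrU B hB))))]
    exact (isPreconnected_of_mem_componentsOf hB).union (r B) (hrB B hB) (hDx _ (hrU B hB))
      (hDp _ (hrU B hB))
  · intro x hx
    obtain ⟨B, hB, hxB⟩ := exists_mem_componentsOf_mem (interior_subset (hKQ hx))
    exact Or.inr ⟨_, ⟨B, hB, rfl⟩, Or.inl hxB⟩
  · refine union_subset (singleton_subset_iff.2 hx₀) ?_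
    rintro x ⟨_, ⟨B, hB, rfl⟩, hx | hx⟩
    · exact hQU (subset_of_mem_componentsOf hB hx)
    · exact hDU _ (hrU B hB) hx

end ComponentFamilies

/-! ### Hulls relative to a bounded solid set, and separation by sets with finitely many components.
-/

section Hulls

open Set Topology

variable {X : Type*} [TopologicalSpace X]

/-- The components of the complement of `A` that are contained in `E`. -/
def holesIn (E A : Set X) : Set (Set X) := {B ∈ componentsOf Aᶜ | B ⊆ E}

/-- The hull of `A` relative to a set `E`. -/
def hullIn (E A : Set X) : Set X := A ∪ ⋃₀ holesIn E A

theorem holesIn_subset (E A : Set X) : holesIn E A ⊆ componentsOf Aᶜ := fun _ h => h.1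

theorem subset_hullIn (E A : Set X) : A ⊆ hullIn E A := subset_union_left

theorem hullIn_subset {E A : Set X} (h : A ⊆ E) : hullIn E A ⊆ E :=
  union_subset h (sUnion_subset fun _ hB => hB.2)

theorem subset_hullIn_of_mem_holesIn {E A B : Set X} (hB : B ∈ holesIn E A) : B ⊆ hullIn E A :=
  fun _ hx => Or.inr ⟨B, hB, hx⟩

theorem componentsOf_compl_hullIn (E A : Set X) :
    componentsOf (hullIn E A)ᶜ = componentsOf Aᶜ \ holesIn E A := by
  rw [hullIn, compl_union_sUnion_componentsOf (holesIn_subset E A)]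
  exact componentsOf_sUnion_of_subset sdiff_subset

theorem IsBoundedSet.mono {A B : Set X} (hB : IsBoundedSet B) (h : A ⊆ B) : IsBoundedSet A :=
  hB.of_isClosed_subset isClosed_closure (closure_mono h)

theorem isBoundedSet_of_isCompact [T2Space X] {A : Set X} (hA : IsCompact A) : IsBoundedSet A := by
  rwa [IsBoundedSet, hA.isClosed.closure_eq]

theorem IsBddSolid.isBoundedSet [T2Space X] {A : Set X} (hA : IsBddSolid A) : IsBoundedSet A :=
  hA.elim (fun h => h.2.1) fun h => isBoundedSet_of_isCompact h.1

theorem IsBddSolid.isSolid {A : Set X} (hA : IsBddSolid A) : IsSolid A :=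
  hA.elim (fun h => h.2.2) fun h => h.2

theorem isBddSemisolidOrCompactConnected_iff {A : Set X} :
    IsBddSemisolidOrCompactConnected A ↔
      (IsCompact A ∧ IsPreconnected A) ∨ (IsOpen A ∧ IsBoundedSet A ∧ IsSemisolid A) := by
  constructor
  · rintro (h | h | h)
    · exact Or.inl ⟨h.1, h.2.1⟩
    · exact Or.inr h
    · exact Or.inl h
  · rintro (h | h)
    · exact Or.inr (Or.inr h)
    · exact Or.inr (Or.inl h)

/-- Only the bounded components of the complement of a subset of a bounded solid set `E` are
contained in `E`. -/
theorem not_isBoundedSet_of_not_subset {A B E : Set X} (hX : ¬ CompactSpace X)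
    (hE : IsSolid E) (hAE : A ⊆ E)
    (hB : B ∈ componentsOf Aᶜ) (hBE : ¬ B ⊆ E) : ¬ IsBoundedSet B := by
  obtain ⟨x, hxB, hxE⟩ := not_subset.1 hBE
  obtain ⟨D, hD, hxD⟩ := exists_mem_componentsOf_mem (S := Eᶜ) hxE
  have hDB : D ⊆ B := subset_component_of_inter_nonempty hB (isPreconnected_of_mem_componentsOf hD)
    ((subset_of_mem_componentsOf hD).trans (compl_subset_compl.2 hAE)) ⟨x, hxD, hxB⟩
  exact fun h => hE.2.2 hX D hD (h.mono hDB)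

/-- If `X` is compact then at most one component of the complement of a subset of a solid set `E`
is not contained in `E`. -/
theorem eq_of_not_subset_of_isSolid [CompactSpace X] {A B C E : Set X} (hE : IsSolid E) (hAE : A ⊆ E)
    (hB : B ∈ componentsOf Aᶜ) (hBE : ¬ B ⊆ E) (hC : C ∈ componentsOf Aᶜ) (hCE : ¬ C ⊆ E) :
    B = C := by
  obtain ⟨x, hxB, hxE⟩ := not_subset.1 hBE
  obtain ⟨y, hyC, hyE⟩ := not_subset.1 hCE
  have h1 : Eᶜ ⊆ Aᶜ := compl_subset_compl.2 hAE
  have h2 := hE.2.1 inferInstance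
  have h3 := subset_component_of_inter_nonempty hB h2 h1 ⟨x, hxE, hxB⟩
  exact eq_of_mem_componentsOf hB hC ⟨y, h3 hyE, hyC⟩

theorem isCompact_frontier_of_isCompact [T2Space X] {N : Set X} (hN : IsCompact N) :
    IsCompact (frontier N) :=
  hN.of_isClosed_subset isClosed_frontier hN.isClosed.frontier_subset

/-- A component of the complement of a closed set `Y`, one that does not meet the frontier of `N`
and adheres to `Y` only inside the interior of `N`, lies in the interior of `N`. -/
theorem subset_interior_of_disjoint_frontier [PreconnectedSpace X] [LocallyConnectedSpace X]
    {Y N O : Set X} (hY : IsClosed Y) (hne : Y.Nonempty) (hYN : Y ⊆ interior N)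
    (hO : O ∈ componentsOf Yᶜ) (hd : Disjoint O (frontier N)) :
    O ⊆ interior N := by
  refine ((isPreconnected_of_mem_componentsOf hO).subset_interior_or_subset_compl hd).resolve_right
    fun h => ?_
  obtain ⟨x, hxO, hxY⟩ := closure_inter_nonempty_of_mem_componentsOf_compl hY hne hO
  have : closure O ⊆ (interior N)ᶜ := closure_minimal
    (h.trans (compl_subset_compl.2 (interior_subset.trans subset_closure)))
    isOpen_interior.isClosed_compl
  exact this hxO (hYN hxY)

/-- In a noncompact space the relative hull therefore does not depend on E and is the solid hull. In
a compact space every component is bounded, and it is E that decides which one counts as outside. -/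
theorem holesIn_eq_of_not_compactSpace [T2Space X] {A E : Set X} (hX : ¬ CompactSpace X)
    (hE : IsBddSolid E) (hAE : A ⊆ E) : holesIn E A = boundedComponentsOf Aᶜ := by
  ext B
  refine and_congr_right fun hB => ⟨fun h => hE.isBoundedSet.mono h, fun h => ?_⟩
  by_contra hBE
  exact not_isBoundedSet_of_not_subset hX hE.isSolid hAE hB hBE h

namespace IsBddSemisolidOrCompactConnected

variable {A B E : Set X}

theorem of_isCompact (h : IsCompact A) (h' : IsPreconnected A) :
    IsBddSemisolidOrCompactConnected A :=
  Or.inr (Or.inr ⟨h, h'⟩)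

theorem isPreconnected (hA : IsBddSemisolidOrCompactConnected A) : IsPreconnected A :=
  (isBddSemisolidOrCompactConnected_iff.1 hA).elim (fun h => h.2) fun h => h.2.2.1

theorem isBoundedSet [T2Space X] (hA : IsBddSemisolidOrCompactConnected A) : IsBoundedSet A :=
  (isBddSemisolidOrCompactConnected_iff.1 hA).elim (fun h => isBoundedSet_of_isCompact h.1)
    fun h => h.2.1

theorem isBddSolid (hA : IsBddSemisolidOrCompactConnected A) (h : IsSolid A) : IsBddSolid A :=
  (isBddSemisolidOrCompactConnected_iff.1 hA).elim (fun h' => Or.inr ⟨h'.1, h⟩)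
    fun h' => Or.inl ⟨h'.1, h'.2.1, h⟩

variable [PreconnectedSpace X] [LocallyConnectedSpace X] [T2Space X]

theorem isPreconnected_union (hA : IsBddSemisolidOrCompactConnected A) (hne : A.Nonempty)
    (hB : B ∈ componentsOf Aᶜ) : IsPreconnected (A ∪ B) := by
  have hBp := isPreconnected_of_mem_componentsOf hB
  rcases isBddSemisolidOrCompactConnected_iff.1 hA with h | h
  · rw [union_comm]
    exact hBp.union_of_closure_inter h.2
      (closure_inter_nonempty_of_mem_componentsOf_compl h.1.isClosed hne hB)
  · exact h.2.2.1.union_of_closure_inter hBp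
      (inter_closure_nonempty_of_mem_componentsOf_compl h.1 hne h.2.2.2 hB)

theorem isPreconnected_union_sUnion (hA : IsBddSemisolidOrCompactConnected A) (hne : A.Nonempty)
    {ℬ : Set (Set X)} (hℬ : ℬ ⊆ componentsOf Aᶜ) : IsPreconnected (A ∪ ⋃₀ ℬ) :=
  hA.isPreconnected.union_sUnion_of_adherent hne fun _ hB =>
    hA.isPreconnected_union hne (hℬ hB)

/-- The complement of B consists of A and the other components, each of which adheres to A. -/
theorem isPreconnected_compl (hA : IsBddSemisolidOrCompactConnected A) (hne : A.Nonempty)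
    (hB : B ∈ componentsOf Aᶜ) : IsPreconnected Bᶜ := by
  have h1 := compl_union_sUnion_componentsOf (A := A)
    (sdiff_subset : componentsOf Aᶜ \ {B} ⊆ _)
  rw [sdiff_sdiff_eq_self (singleton_subset_iff.2 hB), sUnion_singleton] at h1
  rw [← h1, compl_compl]
  exact hA.isPreconnected_union_sUnion hne sdiff_subset

/-- Since the complement of B is connected, it is its own only component. If it were bounded along
with B, the whole space would be compact. -/
theorem isBddSolid_of_mem_componentsOf (hA : IsBddSemisolidOrCompactConnected A)
    (hne : A.Nonempty) (hB : B ∈ componentsOf Aᶜ) (hbdd : IsBoundedSet B) : IsBddSolid B := by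
  have hBp := isPreconnected_of_mem_componentsOf hB
  have hBc := hA.isPreconnected_compl hne hB
  have hsolid : IsSolid B := by
    refine ⟨hBp, fun _ => hBc, fun hX D hD hDb => hX ?_⟩
    have hDe : D = Bᶜ := (subset_of_mem_componentsOf hD).antisymm
      (subset_component_of_inter_nonempty hD hBc le_rfl (by
        obtain ⟨x, hx⟩ := nonempty_of_mem_componentsOf hD
        exact ⟨x, subset_of_mem_componentsOf hD hx, hx⟩))
    refine ⟨?_⟩
    have := hbdd.union hDb
    rwa [← closure_union, hDe, union_compl_self, closure_univ] at this
  rcases isBddSemisolidOrCompactConnected_iff.1 hA with h | h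
  · exact Or.inl ⟨isOpen_of_mem_componentsOf h.1.isClosed.isOpen_compl hB, hbdd, hsolid⟩
  · refine Or.inr ⟨?_, hsolid⟩
    rwa [IsBoundedSet, (isClosed_of_mem_componentsOf h.1.isClosed_compl hB).closure_eq] at hbdd

theorem of_mem_componentsOf (hA : IsBddSemisolidOrCompactConnected A)
    (hne : A.Nonempty) (hB : B ∈ componentsOf Aᶜ) (hbdd : IsBoundedSet B) :
    IsBddSemisolidOrCompactConnected B := by
  have h : (componentsOf Bᶜ).Finite := by
    rw [← sUnion_singleton Bᶜ]
    exact finite_componentsOf_sUnion (finite_singleton _)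
      (by simpa using hA.isPreconnected_compl hne hB)
  rcases hA.isBddSolid_of_mem_componentsOf hne hB hbdd with h' | h'
  · exact Or.inr (Or.inl ⟨h'.1, h'.2.1, h'.2.2.1, h⟩)
  · exact of_isCompact h'.1 h'.2.1

theorem isBddSolid_of_mem_holesIn (hA : IsBddSemisolidOrCompactConnected A)
    (hne : A.Nonempty) (hE : IsBddSolid E) (hB : B ∈ holesIn E A) : IsBddSolid B :=
  hA.isBddSolid_of_mem_componentsOf hne hB.1 (hE.isBoundedSet.mono hB.2)

/-- The complement of the hull consists of the components that leave E. In a compact space there is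
at most one of them, and in a noncompact space all are unbounded. -/
theorem isSolid_hullIn (hA : IsBddSemisolidOrCompactConnected A) (hne : A.Nonempty)
    (hE : IsSolid E) (hAE : A ⊆ E) : IsSolid (hullIn E A) := by
  refine ⟨hA.isPreconnected_union_sUnion hne (holesIn_subset E A), fun hX => ?_,
    fun hX B hB => ?_⟩
  · rw [hullIn, compl_union_sUnion_componentsOf (holesIn_subset E A)]
    have hsub : (componentsOf Aᶜ \ holesIn E A).Subsingleton := fun B hB C hC =>
      eq_of_not_subset_of_isSolid hE hAE hB.1 (fun h => hB.2 ⟨hB.1, h⟩) hC.1 (fun h => hC.2 ⟨hC.1, h⟩)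
    rcases hsub.eq_empty_or_singleton with h | ⟨B, hB⟩
    · rw [h, sUnion_empty]
      exact isPreconnected_empty
    · rw [hB, sUnion_singleton]
      exact isPreconnected_of_mem_componentsOf (hB.ge rfl).1
  · rw [componentsOf_compl_hullIn] at hB
    exact not_isBoundedSet_of_not_subset hX hE hAE hB.1 fun h => hB.2 ⟨hB.1, h⟩

theorem isCompactSolid_hullIn (hAc : IsCompact A) (hAp : IsPreconnected A) (hne : A.Nonempty)
    (hE : IsSolid E) (hEb : IsBoundedSet E) (hAE : A ⊆ E) : IsCompactSolid (hullIn E A) := by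
  refine ⟨hEb.of_isClosed_subset ?_ ((hullIn_subset hAE).trans subset_closure),
    (of_isCompact hAc hAp).isSolid_hullIn hne hE hAE⟩
  rw [← isOpen_compl_iff, hullIn, compl_union_sUnion_componentsOf (holesIn_subset E A)]
  exact isOpen_sUnion fun B hB => isOpen_of_mem_componentsOf hAc.isClosed.isOpen_compl hB.1

theorem isBddSolid_hullIn (hA : IsBddSemisolidOrCompactConnected A) (hne : A.Nonempty)
    (hE : IsBddSolid E) (hAE : A ⊆ E) : IsBddSolid (hullIn E A) := by
  rcases isBddSemisolidOrCompactConnected_iff.1 hA with h | h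
  · exact Or.inr (isCompactSolid_hullIn h.1 h.2 hne hE.isSolid hE.isBoundedSet hAE)
  · refine Or.inl ⟨?_, hE.isBoundedSet.mono (hullIn_subset hAE),
      hA.isSolid_hullIn hne hE.isSolid hAE⟩
    rw [← isClosed_compl_iff, hullIn, compl_union_sUnion_componentsOf (holesIn_subset E A)]
    exact isClosed_sUnion_of_finite (h.2.2.2.subset sdiff_subset) fun B hB =>
      isClosed_of_mem_componentsOf h.1.isClosed_compl hB.1

theorem hullIn (hA : IsBddSemisolidOrCompactConnected A) (hne : A.Nonempty)
    (hE : IsBddSolid E) (hAE : A ⊆ E) : IsBddSemisolidOrCompactConnected (hullIn E A) := by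
  rcases isBddSemisolidOrCompactConnected_iff.1 hA with h | h
  · have := isCompactSolid_hullIn h.1 h.2 hne hE.isSolid hE.isBoundedSet hAE
    exact of_isCompact this.1 this.2.1
  · refine (hA.isBddSolid_hullIn hne hE hAE).elim (fun h' => Or.inr (Or.inl
      ⟨h'.1, h'.2.1, h'.2.2.1, ?_⟩)) fun h' => of_isCompact h'.1 h'.2.1
    rw [componentsOf_compl_hullIn]
    exact h.2.2.2.subset sdiff_subset

end IsBddSemisolidOrCompactConnected

theorem isBddSolid_univ [CompactSpace X] [PreconnectedSpace X] : IsBddSolid (univ : Set X) :=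
  Or.inr ⟨isCompact_univ, isPreconnected_univ, fun _ => by simpa using isPreconnected_empty,
    fun h => (h inferInstance).elim⟩

variable [PreconnectedSpace X] [LocallyConnectedSpace X] [T2Space X] [LocallyCompactSpace X]

/-- A compact subset of a bounded open solid set is contained in a compact solid subset. -/
theorem exists_isCompactSolid_between {K U : Set X} (hK : IsCompact K) (hU : IsBddOpenSolid U)
    (hne : U.Nonempty) (hKU : K ⊆ U) : ∃ C, IsCompactSolid C ∧ K ⊆ C ∧ C ⊆ U := by
  obtain ⟨C, hC, hCp, hCne, hKC, hCU⟩ :=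
    exists_compact_connected_between hK hU.1 hU.2.2.1 hne hKU
  exact ⟨hullIn U C, IsBddSemisolidOrCompactConnected.isCompactSolid_hullIn hC hCp hCne hU.2.2
    hU.2.1 hCU, hKC.trans (subset_hullIn U C), hullIn_subset hCU⟩

/-- A nonempty bounded set is contained in a compact connected set. -/
theorem IsBoundedSet.exists_compact_connected {A : Set X} (hA : IsBoundedSet A)
    (hne : A.Nonempty) : ∃ C, IsCompact C ∧ IsPreconnected C ∧ C.Nonempty ∧ A ⊆ C := by
  obtain ⟨C, hC, hCp, hCne, hAC, -⟩ := exists_compact_connected_between hA isOpen_univ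
    isPreconnected_univ ⟨hne.some, mem_univ _⟩ (subset_univ _)
  exact ⟨C, hC, hCp, hCne, subset_closure.trans hAC⟩

/-- In the noncompact case all bounded complementary components of a compact connected C ⊇ A are
filled in. The result stays bounded: for a compact neighbourhood N of C, only finitely many
components meet the frontier of N, and each of the others lies inside N. -/
theorem IsBoundedSet.exists_isBddSolid {A : Set X} (hA : IsBoundedSet A) (hne : A.Nonempty) :
    ∃ E, IsBddSolid E ∧ A ⊆ E := by
  by_cases hX : CompactSpace X
  · exact ⟨univ, isBddSolid_univ, subset_univ _⟩
  obtain ⟨C, hC, hCp, hCne, hAC⟩ := hA.exists_compact_connected hne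
  obtain ⟨N, hN, hCN⟩ := exists_compact_superset hC
  set ℬ := boundedComponentsOf Cᶜ with hℬ
  have hℬc : ℬ ⊆ componentsOf Cᶜ := fun _ h => h.1
  have hfrC : frontier N ⊆ Cᶜ := fun x hx hxC => hx.2 (hCN hxC)
  have hfr : IsCompact (frontier N) :=
    hN.of_isClosed_subset isClosed_frontier hN.isClosed.frontier_subset
  have hfin := finite_componentsOf_meeting hC.isClosed.isOpen_compl hfr hfrC
  set ℱ := {B ∈ componentsOf Cᶜ | (B ∩ frontier N).Nonempty} with hℱ
  have hcpt : IsCompact (N ∪ ⋃ B ∈ (ℱ ∩ ℬ), closure B) :=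
    hN.union ((hfin.subset inter_subset_left).isCompact_biUnion fun B hB => hB.2.2)
  have hcl : IsClosed (C ∪ ⋃₀ ℬ) := by
    rw [← isOpen_compl_iff, compl_union_sUnion_componentsOf hℬc]
    exact isOpen_sUnion fun B hB => isOpen_of_mem_componentsOf hC.isClosed.isOpen_compl hB.1
  refine ⟨C ∪ ⋃₀ ℬ, Or.inr ⟨hcpt.of_isClosed_subset hcl ?_, ?_, fun h => (hX h).elim,
    fun _ B hB => ?_⟩, hAC.trans subset_union_left⟩
  · rintro x (hx | ⟨B, hB, hxB⟩)
    · exact Or.inl (interior_subset (hCN hx))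
    · by_cases hBN : (B ∩ frontier N).Nonempty
      · exact Or.inr (mem_iUnion₂.2 ⟨B, ⟨⟨hB.1, hBN⟩, hB⟩, subset_closure hxB⟩)
      · exact Or.inl (interior_subset (subset_interior_of_disjoint_frontier hC.isClosed hCne hCN
          hB.1 (disjoint_iff_inter_eq_empty.2 (not_nonempty_iff_eq_empty.1 hBN)) hxB))
  · exact (IsBddSemisolidOrCompactConnected.of_isCompact hC hCp).isPreconnected_union_sUnion hCne
      hℬc
  · rw [compl_union_sUnion_componentsOf hℬc, componentsOf_sUnion_of_subset sdiff_subset] at hB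
    exact fun h => hB.2 ⟨hB.1, h⟩

/-- A nonempty compact subset `M` of an open set `V` is disjoint from a closed set with finitely
many components that contains the complement of some compact subset of `V`. -/
theorem exists_isClosed_finite_componentsOf {M V : Set X} (hM : IsCompact M) (hne : M.Nonempty)
    (hV : IsOpen V) (hMV : M ⊆ V) :
    ∃ Z N, IsClosed Z ∧ (componentsOf Z).Finite ∧ Disjoint Z M ∧ IsCompact N ∧ N ⊆ V ∧
      Zᶜ ⊆ N := by
  obtain ⟨N, hN, hMN, hNV⟩ := exists_compact_between hM hV hMV
  obtain ⟨T, hT, hfrT, hTM, hTfin⟩ := exists_compact_finite_componentsOf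
    (isCompact_frontier_of_isCompact hN) hM.isClosed.isOpen_compl
    fun x hx hxM => hx.2 (hMN hxM)
  -- The complement of N may have infinitely many components, but each adheres to the frontier of N,
  -- hence to T, which has only finitely many components.
  have hZ : T ∪ (interior N)ᶜ = T ∪ ⋃₀ componentsOf Nᶜ := by
    rw [sUnion_componentsOf]
    ext x
    constructor
    · rintro (hx | hx)
      · exact Or.inl hx
      · by_cases hxN : x ∈ N
        · exact Or.inl (interior_subset (hfrT ⟨subset_closure hxN, hx⟩))
        · exact Or.inr hxN
    · rintro (hx | hx)
      · exact Or.inl hx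
      · exact Or.inr fun h => hx (interior_subset h)
  refine ⟨T ∪ (interior N)ᶜ, N, hT.isClosed.union isOpen_interior.isClosed_compl, ?_, ?_, hN, hNV,
    ?_⟩
  · rw [hZ]
    refine finite_componentsOf_union_sUnion hTfin
      (fun B hB => isPreconnected_of_mem_componentsOf hB) fun B hB => ?_
    obtain ⟨x, hxB, hxN⟩ := closure_inter_nonempty_of_mem_componentsOf_compl hN.isClosed
      (hne.mono (hMN.trans interior_subset)) hB
    refine ⟨x, hxB, interior_subset (hfrT ⟨subset_closure hxN, fun hxi => ?_⟩)⟩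
    have hcl : closure B ⊆ (interior N)ᶜ := closure_minimal
      ((subset_of_mem_componentsOf hB).trans (compl_subset_compl.2 interior_subset))
      isOpen_interior.isClosed_compl
    exact hcl hxB hxi
  · rw [disjoint_left]
    rintro x (hx | hx) hxM
    · exact hTM hx hxM
    · exact hx (hMN hxM)
  · rw [compl_union, compl_compl]
    exact inter_subset_right.trans interior_subset

/-- Separation of a compact set `K` from the complement of an open set `V` by sets with finitely
many components. -/
theorem exists_separation {K M W V : Set X} (hK : IsCompact K) (hKne : K.Nonempty)
    (hM : IsCompact M) (hW : IsOpen W) (hV : IsOpen V) (hKW : K ⊆ W) (hWV : W ⊆ V) (hMV : M ⊆ V) :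
    ∃ Q Z N, IsCompact Q ∧ K ⊆ interior Q ∧ Q ⊆ W ∧ IsClosed Z ∧ Disjoint Q Z ∧ Disjoint M Z ∧
      IsCompact N ∧ N ⊆ V ∧ Zᶜ ⊆ N ∧ (componentsOf Q).Finite ∧ (componentsOf Z).Finite ∧
      (componentsOf (Q ∪ Z)ᶜ).Finite := by
  obtain ⟨Q₀, hQ₀, hKQ₀, hQ₀W, hQ₀fin⟩ := exists_compact_finite_componentsOf hK hW hKW
  have hQ₀ne : Q₀.Nonempty := hKne.mono (hKQ₀.trans interior_subset)
  obtain ⟨Z₀, N₁, hZ₀, hZ₀fin, hZ₀d, hN₁, hN₁V, hZ₀N₁⟩ := exists_isClosed_finite_componentsOf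
    (hM.union hQ₀) (hQ₀ne.mono subset_union_right) hV (union_subset hMV (hQ₀W.trans hWV))
  obtain ⟨hMZ₀, hQ₀Z₀⟩ := disjoint_union_right.1 hZ₀d
  obtain ⟨N, hN, hQ₀N, hNW⟩ := exists_compact_between hQ₀ (hW.inter hZ₀.isOpen_compl)
    (subset_inter hQ₀W fun x hx hxZ => disjoint_left.1 hQ₀Z₀ hxZ hx)
  have hY : IsClosed (Q₀ ∪ Z₀) := hQ₀.isClosed.union hZ₀
  have hYne : (Q₀ ∪ Z₀).Nonempty := hQ₀ne.mono subset_union_left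
  set 𝒪 := componentsOf (Q₀ ∪ Z₀)ᶜ with h𝒪
  have hadh : ∀ O ∈ 𝒪, (closure O ∩ (Q₀ ∪ Z₀)).Nonempty := fun O hO =>
    closure_inter_nonempty_of_mem_componentsOf_compl hY hYne hO
  have hOopen : ∀ O ∈ 𝒪, IsOpen O := fun O hO => isOpen_of_mem_componentsOf hY.isOpen_compl hO
  -- The gap between Q₀ and Z₀ may have infinitely many components. Those inside N are given to Q₀,
  -- and those outside N that avoid M to Z₀; only finitely many will be left.
  set 𝒬 := {O ∈ 𝒪 | O ⊆ interior N} with h𝒬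
  set 𝒵 := {O ∈ 𝒪 | O ⊆ Nᶜ ∧ Disjoint O M} with h𝒵
  have hcover : ∀ x, x ∈ Q₀ ∨ x ∈ Z₀ ∨ ∃ O ∈ 𝒪, x ∈ O := by
    intro x
    by_cases hx : x ∈ Q₀ ∪ Z₀
    · exact hx.imp_right Or.inl
    · exact Or.inr (Or.inr (exists_mem_componentsOf_mem (S := (Q₀ ∪ Z₀)ᶜ) hx))
  have hOQ : ∀ O ∈ 𝒪, ∀ x ∈ O, x ∉ Q₀ := fun O hO x hx h =>
    subset_of_mem_componentsOf hO hx (Or.inl h)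
  have hOZ : ∀ O ∈ 𝒪, ∀ x ∈ O, x ∉ Z₀ := fun O hO x hx h =>
    subset_of_mem_componentsOf hO hx (Or.inr h)
  have hQN : Q₀ ∪ ⋃₀ 𝒬 ⊆ interior N := union_subset hQ₀N (sUnion_subset fun O hO => hO.2)
  have hZN : Z₀ ∪ ⋃₀ 𝒵 ⊆ (interior N)ᶜ := union_subset
    (fun x hx hxN => (hNW (interior_subset hxN)).2 hx)
    (sUnion_subset fun O hO => hO.2.1.trans (compl_subset_compl.2 interior_subset))
  -- An infinite union of components need not look closed. Rewriting it as a closed set minus the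
  -- remaining open components shows that it is; the same is done for Z.
  have hQeq : Q₀ ∪ ⋃₀ 𝒬 = N \ ⋃₀ (𝒪 \ 𝒬) := by
    ext x
    constructor
    · intro hx
      refine ⟨interior_subset (hQN hx), ?_⟩
      rintro ⟨O, hO, hxO⟩
      rcases hx with hx | ⟨O', hO', hxO'⟩
      · exact hOQ O hO.1 x hxO hx
      · exact hO.2 (eq_of_mem_componentsOf hO'.1 hO.1 ⟨x, hxO', hxO⟩ ▸ hO')
    · rintro ⟨hxN, hx⟩
      rcases hcover x with h | h | ⟨O, hO, hxO⟩
      · exact Or.inl h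
      · exact ((hNW hxN).2 h).elim
      · by_contra hcon
        exact hx ⟨O, ⟨hO, fun hO' => hcon (Or.inr ⟨O, hO', hxO⟩)⟩, hxO⟩
  have hZeq : Z₀ ∪ ⋃₀ 𝒵 = (interior N)ᶜ \ ⋃₀ (𝒪 \ 𝒵) := by
    ext x
    constructor
    · intro hx
      refine ⟨hZN hx, ?_⟩
      rintro ⟨O, hO, hxO⟩
      rcases hx with hx | ⟨O', hO', hxO'⟩
      · exact hOZ O hO.1 x hxO hx
      · exact hO.2 (eq_of_mem_componentsOf hO'.1 hO.1 ⟨x, hxO', hxO⟩ ▸ hO')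
    · rintro ⟨hxN, hx⟩
      rcases hcover x with h | h | ⟨O, hO, hxO⟩
      · exact (hxN (hQ₀N h)).elim
      · exact Or.inl h
      · by_contra hcon
        exact hx ⟨O, ⟨hO, fun hO' => hcon (Or.inr ⟨O, hO', hxO⟩)⟩, hxO⟩
  have hQcl : IsClosed (Q₀ ∪ ⋃₀ 𝒬) := by
    rw [hQeq]
    exact hN.isClosed.sdiff (isOpen_sUnion fun O hO => hOopen O hO.1)
  refine ⟨Q₀ ∪ ⋃₀ 𝒬, Z₀ ∪ ⋃₀ 𝒵, N₁, hN.of_isClosed_subset hQcl (hQN.trans interior_subset),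
    hKQ₀.trans (interior_mono subset_union_left), ?_, ?_, ?_, ?_, hN₁, hN₁V, ?_, ?_, ?_, ?_⟩
  · exact fun x hx => (hNW (interior_subset (hQN hx))).1
  · rw [hZeq]
    exact isOpen_interior.isClosed_compl.sdiff (isOpen_sUnion fun O hO => hOopen O hO.1)
  · exact disjoint_left.2 fun x hx hx' => hZN hx' (hQN hx)
  · rw [disjoint_union_right, disjoint_sUnion_right]
    exact ⟨hMZ₀.symm, fun O hO => hO.2.2.symm⟩
  · exact (compl_subset_compl.2 subset_union_left).trans hZ₀N₁
  · refine finite_componentsOf_union_sUnion hQ₀fin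
      (fun O hO => isPreconnected_of_mem_componentsOf hO.1) fun O hO => ?_
    obtain ⟨x, hxO, hx⟩ := hadh O hO.1
    have : x ∈ N := closure_minimal (hO.2.trans interior_subset) hN.isClosed hxO
    exact ⟨x, hxO, hx.resolve_right (hNW this).2⟩
  · refine finite_componentsOf_union_sUnion hZ₀fin
      (fun O hO => isPreconnected_of_mem_componentsOf hO.1) fun O hO => ?_
    obtain ⟨x, hxO, hx⟩ := hadh O hO.1
    have : x ∈ (interior N)ᶜ := closure_minimal
      (hO.2.1.trans (compl_subset_compl.2 interior_subset)) isOpen_interior.isClosed_compl hxO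
    exact ⟨x, hxO, hx.resolve_left fun h => this (hQ₀N h)⟩
  · have hcompl : (Q₀ ∪ ⋃₀ 𝒬 ∪ (Z₀ ∪ ⋃₀ 𝒵))ᶜ = ⋃₀ (𝒪 \ (𝒬 ∪ 𝒵)) := by
      rw [← compl_union_sUnion_componentsOf (A := Q₀ ∪ Z₀)
        (union_subset (fun _ h => h.1) fun _ h => h.1), sUnion_union, union_union_union_comm]
    rw [hcompl, componentsOf_sUnion_of_subset sdiff_subset]
    -- A gap component given to neither side must meet this compact subset of the gap, so there are
    -- finitely many.
    have hF : frontier N ∪ M \ interior N ⊆ (Q₀ ∪ Z₀)ᶜ := by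
      rintro x (hx | hx) (h | h)
      · exact hx.2 (hQ₀N h)
      · exact (hNW (hN.isClosed.frontier_subset hx)).2 h
      · exact hx.2 (hQ₀N h)
      · exact disjoint_left.1 hMZ₀ h hx.1
    refine (finite_componentsOf_meeting hY.isOpen_compl
      ((isCompact_frontier_of_isCompact hN).union (hM.diff isOpen_interior)) hF).subset ?_
    rintro O ⟨hO, hOn⟩
    refine ⟨hO, ?_⟩
    by_contra hcon
    rw [inter_union_distrib_left, union_nonempty, not_or, not_nonempty_iff_eq_empty,
      not_nonempty_iff_eq_empty, ← disjoint_iff_inter_eq_empty] at hcon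
    rcases (isPreconnected_of_mem_componentsOf hO).subset_interior_or_subset_compl hcon.1
      with h | h
    · exact hOn (Or.inl ⟨hO, h⟩)
    · rw [hN.isClosed.closure_eq] at h
      refine hOn (Or.inr ⟨hO, h, disjoint_left.2 fun x hxO hxM => ?_⟩)
      exact (hcon.2.le ⟨hxO, hxM, fun hxi => h hxO (interior_subset hxi)⟩ :)

end Hulls

/-! ### Superadditivity on bounded solid sets and the decomposition of relative hulls. -/

section SolidSums

open Set Topology

variable {X : Type*}

open Classical in
-- A nonempty C lies in exactly one member of the disjoint family 𝒢, so exchanging the sums regroups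
-- the terms. No finiteness of 𝒢 is needed.
theorem sum_eq_tsum_sum_filter_subset (f : Set X → ℝ≥0∞) {𝒞 : Finset (Set X)} {𝒢 : Set (Set X)}
    (hd : 𝒢.PairwiseDisjoint id) (hne : ∀ C ∈ 𝒞, C.Nonempty)
    (hsub : ∀ C ∈ 𝒞, ∃ G ∈ 𝒢, C ⊆ G) :
    ∑ C ∈ 𝒞, f C = ∑' G : 𝒢, ∑ C ∈ 𝒞 with C ⊆ (G : Set X), f C := by
  simp_rw [Finset.sum_filter]
  rw [Summable.tsum_finsetSum fun _ _ => ENNReal.summable]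
  refine Finset.sum_congr rfl fun C hC => ?_
  obtain ⟨G, hG, hCG⟩ := hsub C hC
  rw [tsum_eq_single ⟨G, hG⟩, if_pos hCG]
  rintro ⟨G', hG'⟩ hne'
  refine if_neg fun hCG' => hne' (Subtype.ext ?_)
  obtain ⟨x, hx⟩ := hne C hC
  exact hd.elim hG' hG (not_disjoint_iff.2 ⟨x, hCG' hx, hCG hx⟩)

variable [TopologicalSpace X]

theorem isCompactSolid_empty [PreconnectedSpace X] : IsCompactSolid (∅ : Set X) := by
  refine ⟨isCompact_empty, isPreconnected_empty, fun _ => ?_, fun hX B hB h => hX ?_⟩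
  · rw [compl_empty]
    exact isPreconnected_univ
  · obtain ⟨x, hx⟩ := nonempty_of_mem_componentsOf hB
    have : univ ⊆ B := subset_component_of_inter_nonempty hB isPreconnected_univ
      (by rw [compl_empty]) ⟨x, mem_univ x, hx⟩
    refine ⟨?_⟩
    rw [← closure_univ]
    rw [← univ_subset_iff.1 this]
    exact h

theorem exists_le_add_of_isLUB {s : Set ℝ≥0} {a ε : ℝ≥0} (h : IsLUB s a) (hne : s.Nonempty)
    (hε : 0 < ε) : ∃ b ∈ s, a ≤ b + ε := by
  by_contra! hcon
  obtain ⟨b, hb⟩ := hne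
  have hle : a ≤ a - ε := h.2 fun c hc => le_tsub_of_add_le_right (hcon c hc).le
  -- Positivity makes the truncated difference `a - ε` strictly smaller than `a`; this is what
  -- nonemptiness of the set is for.
  have : 0 < a := (by positivity : 0 ≤ b + ε).trans_lt (hcon b hb)
  exact (tsub_lt_self this hε).not_ge hle

namespace IsSolidSetFunction

variable {lam : Set X → ℝ≥0} (hlam : IsSolidSetFunction lam) {ι : Type*}
include hlam

theorem sum_le_of_isCompactSolid {s : Finset ι} {C : ι → Set X} {D : Set X}
    (hC : ∀ i ∈ s, IsCompactSolid (C i)) (hD : IsCompactSolid D)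
    (hd : (s : Set ι).PairwiseDisjoint C) (hsub : ∀ i ∈ s, C i ⊆ D) :
    ∑ i ∈ s, lam (C i) ≤ lam D := by
  have h := hlam.superadd s.card (fun i => C (s.equivFin.symm i)) D
    (fun i => hC _ (s.equivFin.symm i).2) hD
    (fun i j hij => hd (s.equivFin.symm i).2 (s.equivFin.symm j).2 fun h => hij
      (s.equivFin.symm.injective (Subtype.ext h)))
    (iUnion_subset fun i => hsub _ (s.equivFin.symm i).2)
  rwa [Equiv.sum_comp s.equivFin.symm fun i => lam (C i), Finset.sum_coe_sort s fun i => lam (C i)]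
    at h

theorem eq_sum_of_isBddSolid {s : Finset ι} {C : ι → Set X} {D : Set X}
    (hC : ∀ i ∈ s, IsBddSolid (C i)) (hD : IsBddSolid D)
    (hd : (s : Set ι).PairwiseDisjoint C) (hsub : D = ⋃ i ∈ s, C i) :
    lam D = ∑ i ∈ s, lam (C i) := by
  have h := hlam.partition s.card (fun i => C (s.equivFin.symm i)) D
    (fun i => hC _ (s.equivFin.symm i).2) hD
    (fun i j hij => hd (s.equivFin.symm i).2 (s.equivFin.symm j).2 fun h => hij
      (s.equivFin.symm.injective (Subtype.ext h))) ?_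
  · rwa [Equiv.sum_comp s.equivFin.symm fun i => lam (C i),
      Finset.sum_coe_sort s fun i => lam (C i)] at h
  · rw [hsub, s.equivFin.symm.surjective.iUnion_comp fun i : s => C i]
    exact biUnion_eq_iUnion (s : Set ι) fun i _ => C i

variable [PreconnectedSpace X]

theorem apply_empty : lam ∅ = 0 := by
  have h := hlam.eq_sum_of_isBddSolid (s := (∅ : Finset Unit)) (C := fun _ => ∅) (by simp)
    (Or.inr isCompactSolid_empty) (by simp) (by simp)
  simpa using h

theorem exists_isCompactSolid_le_add {A : Set X} (hA : IsBddSolid A) {ε : ℝ≥0} (hε : 0 < ε) :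
    ∃ K, IsCompactSolid K ∧ K ⊆ A ∧ lam A ≤ lam K + ε := by
  rcases hA with h | h
  · obtain ⟨_, ⟨K, hK, hKA, rfl⟩, hb⟩ := exists_le_add_of_isLUB (hlam.inner_regular A h)
      ⟨_, ∅, isCompactSolid_empty, empty_subset A, rfl⟩ hε
    exact ⟨K, hK, hKA, hb⟩
  · exact ⟨A, h, le_rfl, le_self_add⟩

variable [LocallyConnectedSpace X] [T2Space X] [LocallyCompactSpace X]

/-- Each member is approximated from within by a compact solid set, which reduces to `superadd`. If
E is open, the compact approximants first have to be enclosed in one compact solid subset of E. The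
error is shared as `δ / (s.card + 1)`, where the extra 1 covers the empty family. -/
theorem sum_le_of_isBddSolid {s : Finset ι} {A : ι → Set X} {E : Set X}
    (hA : ∀ i ∈ s, IsBddSolid (A i)) (hE : IsBddSolid E)
    (hd : (s : Set ι).PairwiseDisjoint A) (hsub : ∀ i ∈ s, A i ⊆ E) :
    ∑ i ∈ s, lam (A i) ≤ lam E := by
  refine le_of_forall_pos_le_add fun δ hδ => ?_
  have hε : 0 < δ / (s.card + 1) := by positivity
  have hex : ∀ i ∈ s, ∃ K, IsCompactSolid K ∧ K ⊆ A i ∧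
      lam (A i) ≤ lam K + δ / (s.card + 1) := fun i hi =>
    hlam.exists_isCompactSolid_le_add (hA i hi) hε
  choose! K hK hKA hlK using hex
  have hKE : ∀ i ∈ s, K i ⊆ E := fun i hi => (hKA i hi).trans (hsub i hi)
  have hKd : (s : Set ι).PairwiseDisjoint K := fun i hi j hj hij =>
    (hd hi hj hij).mono (hKA i hi) (hKA j hj)
  have hle : ∑ i ∈ s, lam (K i) ≤ lam E := by
    by_cases hEc : IsCompactSolid E
    · exact hlam.sum_le_of_isCompactSolid hK hEc hKd hKE
    · have hEo := hE.resolve_right hEc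
      have hne : E.Nonempty := by
        rw [nonempty_iff_ne_empty]
        rintro rfl
        exact hEc isCompactSolid_empty
      obtain ⟨C, hC, hKC, hCE⟩ := exists_isCompactSolid_between
        (s.isCompact_biUnion fun i hi => (hK i hi).1) hEo hne (iUnion₂_subset hKE)
      exact (hlam.sum_le_of_isCompactSolid hK hC hKd
        fun i hi => (subset_biUnion_of_mem (u := K) (Finset.mem_coe.2 hi)).trans hKC).trans
        ((hlam.inner_regular E hEo).1 ⟨C, hC, hCE, rfl⟩)
  calc ∑ i ∈ s, lam (A i) ≤ ∑ i ∈ s, (lam (K i) + δ / (s.card + 1)) := Finset.sum_le_sum hlK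
    _ = ∑ i ∈ s, lam (K i) + s.card * (δ / (s.card + 1)) := by
      rw [Finset.sum_add_distrib, Finset.sum_const, nsmul_eq_mul]
    _ ≤ lam E + δ := by
      refine add_le_add hle ?_
      rw [mul_div_assoc', div_le_iff₀ (by positivity), mul_comm]
      gcongr
      exact le_self_add

variable {A E : Set X}

theorem tsum_holesIn_le (hA : IsBddSemisolidOrCompactConnected A) (hne : A.Nonempty)
    (hE : IsBddSolid E) (hAE : A ⊆ E) :
    ∑' B : holesIn E A, (lam B : ℝ≥0∞) ≤ lam (hullIn E A) := by
  rw [ENNReal.tsum_eq_iSup_sum]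
  refine iSup_le fun s => ?_
  rw [← ENNReal.ofNNReal_finsetSum, ENNReal.coe_le_coe]
  refine hlam.sum_le_of_isBddSolid (fun B _ => hA.isBddSolid_of_mem_holesIn hne hE B.2)
    (hA.isBddSolid_hullIn hne hE hAE) (fun B _ C _ hBC => ?_)
    fun B _ => subset_hullIn_of_mem_holesIn B.2
  exact pairwiseDisjoint_componentsOf Aᶜ B.2.1 C.2.1 fun h => hBC (Subtype.ext h)

theorem holesSum_le (hA : IsBddSemisolidOrCompactConnected A) (hne : A.Nonempty) :
    holesSum lam A ≤ lam (solidHull A) := by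
  by_cases hX : CompactSpace X
  · have hb : boundedComponentsOf Aᶜ = holesIn univ A := by
      ext B
      exact and_congr_right fun _ => ⟨fun _ => subset_univ _, fun _ => isClosed_closure.isCompact⟩
    rw [holesSum, solidHull, hb]
    exact hlam.tsum_holesIn_le hA hne isBddSolid_univ (subset_univ _)
  · obtain ⟨E, hE, hAE⟩ := hA.isBoundedSet.exists_isBddSolid hne
    rw [holesSum, solidHull, ← holesIn_eq_of_not_compactSpace hX hE hAE]
    exact hlam.tsum_holesIn_le hA hne hE hAE

/-- The decomposition of the hull of `A` relative to an arbitrary bounded solid set. -/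
theorem lambdaOne_add_tsum_holesIn (hA : IsBddSemisolidOrCompactConnected A) (hne : A.Nonempty)
    (hE : IsBddSolid E) (hAE : A ⊆ E) :
    lambdaOne lam A + ∑' B : holesIn E A, (lam B : ℝ≥0∞) = lam (hullIn E A) := by
  by_cases hX : CompactSpace X
  · have hb : boundedComponentsOf Aᶜ = componentsOf Aᶜ := by
      ext B
      exact ⟨fun h => h.1, fun h => ⟨h, isClosed_closure.isCompact⟩⟩
    have hu : solidHull A = univ := by
      rw [solidHull, hb, sUnion_componentsOf, union_compl_self]
    have hle := hlam.tsum_holesIn_le hA hne hE hAE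
    by_cases hall : holesIn E A = componentsOf Aᶜ
    · have hh : hullIn E A = univ := by
        rw [hullIn, hall, sUnion_componentsOf, union_compl_self]
      rw [lambdaOne, hh, holesSum, hb, ← hall, hu]
      rw [hh] at hle
      exact tsub_add_cancel_of_le hle
    · obtain ⟨B, hB, hBE⟩ : ∃ B ∈ componentsOf Aᶜ, ¬ B ⊆ E := by
        by_contra! hcon
        exact hall (Subset.antisymm (holesIn_subset E A) fun B hB => ⟨hB, hcon B hB⟩)
      have hcomp : componentsOf Aᶜ = insert B (holesIn E A) := by
        ext C
        constructor
        · intro hC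
          by_cases hCE : C ⊆ E
          · exact Or.inr ⟨hC, hCE⟩
          · exact Or.inl (eq_of_not_subset_of_isSolid hE.isSolid hAE hC hCE hB hBE)
        · rintro (rfl | hC)
          · exact hB
          · exact hC.1
      have hBn : B ∉ holesIn E A := fun h => hBE h.2
      have hcompl : (hullIn E A)ᶜ = B := by
        rw [hullIn, compl_union_sUnion_componentsOf (holesIn_subset E A), hcomp,
          insert_sdiff_of_notMem _ hBn, Set.sdiff_self, insert_empty_eq, sUnion_singleton]
      have hBs : IsBddSolid B := hA.isBddSolid_of_mem_componentsOf hne hB isClosed_closure.isCompact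
      -- The space is the disjoint union of the relative hull and the single component B that leaves
      -- E. By `partition` the term `lam B` occurs both in the value of the solid hull, here the
      -- whole space, and in the sum over the holes, and so it cancels.
      have hadd : lam univ = lam (hullIn E A) + lam B := by
        have := hlam.eq_sum_of_isBddSolid (s := (Finset.univ : Finset Bool))
          (C := fun b => cond b (hullIn E A) B) (D := univ) ?_ isBddSolid_univ ?_ ?_
        · simpa using this
        · rintro (_ | _) -
          · exact hBs
          · exact hA.isBddSolid_hullIn hne hE hAE
        · rintro (_ | _) - (_ | _) - hne'
          · exact (hne' rfl).elim
          · exact hcompl ▸ disjoint_compl_left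
          · exact hcompl ▸ disjoint_compl_right
          · exact (hne' rfl).elim
        · ext x
          by_cases hx : x ∈ hullIn E A <;> simp [← hcompl, hx]
      have hsum : holesSum lam A = lam B + ∑' C : holesIn E A, (lam C : ℝ≥0∞) := by
        rw [holesSum, hb, hcomp, insert_eq, ENNReal.summable.tsum_union_disjoint
          (f := fun C : Set X => (lam C : ℝ≥0∞)) (disjoint_singleton_left.2 hBn) ENNReal.summable]
        simp
      rw [lambdaOne, hu, hsum, hadd, ENNReal.coe_add, add_comm (lam B : ℝ≥0∞),
        ENNReal.add_sub_add_eq_sub_right ENNReal.coe_ne_top, tsub_add_cancel_of_le hle]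
  · have h1 := holesIn_eq_of_not_compactSpace hX hE hAE
    have hle := hlam.holesSum_le hA hne
    rw [hullIn, h1]
    exact tsub_add_cancel_of_le hle

/-- The choice E = A leaves no holes and makes the relative hull equal to A, even in a compact
space, where the solid hull is everything. -/
theorem lambdaOne_of_isSolid (hA : IsBddSemisolidOrCompactConnected A) (hne : A.Nonempty)
    (hs : IsSolid A) : lambdaOne lam A = lam A := by
  have h := hlam.lambdaOne_add_tsum_holesIn hA hne (hA.isBddSolid hs) le_rfl
  have h0 : holesIn A A = ∅ := by
    refine eq_empty_iff_forall_notMem.2 fun B hB => ?_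
    obtain ⟨x, hx⟩ := nonempty_of_mem_componentsOf hB.1
    exact subset_of_mem_componentsOf hB.1 hx (hB.2 hx)
  rw [hullIn, h0] at h
  simpa using h

end IsSolidSetFunction

end SolidSums

/-! ### Superadditivity and additivity of `lambdaOne` on finite disjoint families. -/

section Partitions

open Set Topology

variable {X : Type*} [TopologicalSpace X]

/-- Finite disjoint families of nonempty sets each of which is semisolid or compact connected. -/
structure IsDisjointFamily (𝒜 : Finset (Set X)) : Prop where
  mem : ∀ A ∈ 𝒜, IsBddSemisolidOrCompactConnected A
  nonempty : ∀ A ∈ 𝒜, A.Nonempty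
  disjoint : (𝒜 : Set (Set X)).PairwiseDisjoint id

theorem IsDisjointFamily.mono {𝒜 ℬ : Finset (Set X)} (h : IsDisjointFamily ℬ) (hs : 𝒜 ⊆ ℬ) :
    IsDisjointFamily 𝒜 :=
  ⟨fun A hA => h.mem A (hs hA), fun A hA => h.nonempty A (hs hA),
    h.disjoint.subset (Finset.coe_subset.2 hs)⟩

/-- A connected set disjoint from `A` lies in a hole of `A` or outside the hull of `A`. -/
theorem exists_holesIn_superset_or_disjoint_hullIn {E A C : Set X} (hC : IsPreconnected C)
    (hne : C.Nonempty) (hd : Disjoint C A) :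
    (∃ B ∈ holesIn E A, C ⊆ B) ∨ Disjoint C (hullIn E A) := by
  obtain ⟨B, hB, hCB⟩ := exists_component_superset hC (subset_compl_iff_disjoint_right.2 hd) hne
  by_cases hBE : B ⊆ E
  · exact Or.inl ⟨B, ⟨hB, hBE⟩, hCB⟩
  · refine Or.inr (disjoint_union_right.2 ⟨hd, disjoint_sUnion_right.2 fun B' hB' => ?_⟩)
    refine (pairwiseDisjoint_componentsOf Aᶜ hB hB'.1 ?_).mono_left hCB
    rintro rfl
    exact hBE hB'.2

variable [PreconnectedSpace X] [LocallyConnectedSpace X] [T2Space X] [LocallyCompactSpace X]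

namespace IsSolidSetFunction

variable {lam : Set X → ℝ≥0} (hlam : IsSolidSetFunction lam)
include hlam

theorem sum_lambdaOne_of_forall_isSolid {𝒜 : Finset (Set X)} {E : Set X} (hE : IsBddSolid E)
    (h𝒜 : IsDisjointFamily 𝒜) (hsub : ∀ A ∈ 𝒜, A ⊆ E) (hs : ∀ A ∈ 𝒜, IsSolid A) :
    ∑ A ∈ 𝒜, lambdaOne lam A ≤ lam E ∧
      (⋃₀ (𝒜 : Set (Set X)) = E → ∑ A ∈ 𝒜, lambdaOne lam A = lam E) := by
  have h1 : ∑ A ∈ 𝒜, lambdaOne lam A = ((∑ A ∈ 𝒜, lam A : ℝ≥0) : ℝ≥0∞) := by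
    rw [ENNReal.ofNNReal_finsetSum]
    exact Finset.sum_congr rfl fun A hA =>
      hlam.lambdaOne_of_isSolid (h𝒜.mem A hA) (h𝒜.nonempty A hA) (hs A hA)
  have h2 : ∀ A ∈ 𝒜, IsBddSolid (id A) := fun A hA => (h𝒜.mem A hA).isBddSolid (hs A hA)
  rw [h1]
  refine ⟨ENNReal.coe_le_coe.2 (hlam.sum_le_of_isBddSolid h2 hE h𝒜.disjoint hsub), fun h => ?_⟩
  rw [ENNReal.coe_inj]
  exact (hlam.eq_sum_of_isBddSolid h2 hE h𝒜.disjoint (by rw [← h, sUnion_eq_biUnion]; rfl)).symm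

open Classical in
/-- `lambdaOne` is superadditive below and additive on partitions of bounded solid sets. -/
theorem sum_lambdaOne_of_card_le (n : ℕ) : ∀ {𝒜 : Finset (Set X)} {E : Set X}, IsBddSolid E →
    IsDisjointFamily 𝒜 → (∀ A ∈ 𝒜, A ⊆ E) → {A ∈ 𝒜 | ¬ IsSolid A}.card ≤ n →
    ∑ A ∈ 𝒜, lambdaOne lam A ≤ lam E ∧
      (⋃₀ (𝒜 : Set (Set X)) = E → ∑ A ∈ 𝒜, lambdaOne lam A = lam E) := by
  induction n with
  | zero =>
    intro 𝒜 E hE h𝒜 hsub hn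
    refine hlam.sum_lambdaOne_of_forall_isSolid hE h𝒜 hsub fun A hA => ?_
    by_contra h
    have := Finset.card_eq_zero.1 (Nat.le_zero.1 hn)
    exact Finset.notMem_empty A (this ▸ Finset.mem_filter.2 ⟨hA, h⟩)
  | succ n ih =>
    intro 𝒜 E hE h𝒜 hsub hn
    by_cases hall : ∀ A ∈ 𝒜, IsSolid A
    · exact hlam.sum_lambdaOne_of_forall_isSolid hE h𝒜 hsub hall
    push Not at hall
    obtain ⟨A, hA, hAs⟩ := hall
    have hAp := h𝒜.mem A hA
    have hAne := h𝒜.nonempty A hA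
    have hAE := hsub A hA
    set H := hullIn E A with hH
    have hHs : IsBddSolid H := hAp.isBddSolid_hullIn hAne hE hAE
    have hHp : IsBddSemisolidOrCompactConnected H := hAp.hullIn hAne hE hAE
    have hHne : H.Nonempty := hAne.mono (subset_hullIn E A)
    have hHl : lambdaOne lam H = lam H := hlam.lambdaOne_of_isSolid hHp hHne hHs.isSolid
    have hdich : ∀ C ∈ 𝒜.erase A, (∃ B ∈ holesIn E A, C ⊆ B) ∨ Disjoint C H := fun C hC =>
      exists_holesIn_superset_or_disjoint_hullIn
        (h𝒜.mem C (Finset.mem_of_mem_erase hC)).isPreconnected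
        (h𝒜.nonempty C (Finset.mem_of_mem_erase hC))
        (h𝒜.disjoint (Finset.mem_of_mem_erase hC) hA (Finset.ne_of_mem_erase hC))
    set 𝒜i := {C ∈ 𝒜.erase A | ∃ B ∈ holesIn E A, C ⊆ B} with h𝒜i
    set 𝒜o := {C ∈ 𝒜.erase A | ¬ ∃ B ∈ holesIn E A, C ⊆ B} with h𝒜o
    have hi : 𝒜i ⊆ 𝒜.erase A := Finset.filter_subset _ _
    have ho : 𝒜o ⊆ 𝒜.erase A := Finset.filter_subset _ _
    have hod : ∀ C ∈ 𝒜o, Disjoint C H := fun C hC =>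
      (hdich C (ho hC)).resolve_left (Finset.mem_filter.1 hC).2
    have hsum : ∑ C ∈ 𝒜, lambdaOne lam C =
        lambdaOne lam A + ∑ C ∈ 𝒜i, lambdaOne lam C + ∑ C ∈ 𝒜o, lambdaOne lam C := by
      rw [← Finset.add_sum_erase 𝒜 _ hA, add_assoc, Finset.sum_filter_add_sum_filter_not]
    have hcard : ({C ∈ 𝒜.erase A | ¬ IsSolid C}).card ≤ n := by
      rw [Finset.filter_erase, Finset.card_erase_of_mem (Finset.mem_filter.2 ⟨hA, hAs⟩)]
      omega
    have hfam := h𝒜.mono (Finset.erase_subset A 𝒜)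
    have hgroup : ∑ C ∈ 𝒜i, lambdaOne lam C =
        ∑' B : holesIn E A, ∑ C ∈ 𝒜i with C ⊆ (B : Set X), lambdaOne lam C :=
      sum_eq_tsum_sum_filter_subset _
        ((pairwiseDisjoint_componentsOf Aᶜ).subset (holesIn_subset E A))
        (hfam.mono hi).nonempty fun C hC => (Finset.mem_filter.1 hC).2
    -- The first use of the induction hypothesis: a hole is a bounded solid set, and its subfamily
    -- omits the nonsolid member A.
    have hhole : ∀ B : holesIn E A,
        ∑ C ∈ 𝒜i with C ⊆ (B : Set X), lambdaOne lam C ≤ lam B ∧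
        (⋃₀ (({C ∈ 𝒜i | C ⊆ (B : Set X)} : Finset (Set X)) : Set (Set X)) = (B : Set X) →
          ∑ C ∈ 𝒜i with C ⊆ (B : Set X), lambdaOne lam C = lam B) := fun B => by
      refine ih (hAp.isBddSolid_of_mem_holesIn hAne hE B.2)
        (hfam.mono ((Finset.filter_subset _ _).trans hi))
        (fun C hC => (Finset.mem_filter.1 hC).2) ((Finset.card_le_card ?_).trans hcard)
      exact Finset.filter_subset_filter _ ((Finset.filter_subset _ _).trans hi)
    have hHo : H ∉ 𝒜o := fun h => hHne.ne_empty (disjoint_self.1 (hod H h))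
    -- The second use: the solid set H stands in for A and all members in its holes, so the count of
    -- nonsolid members drops again.
    have houter : ∑ C ∈ insert H 𝒜o, lambdaOne lam C ≤ lam E ∧
        (⋃₀ ((insert H 𝒜o : Finset (Set X)) : Set (Set X)) = E →
          ∑ C ∈ insert H 𝒜o, lambdaOne lam C = lam E) := by
      refine ih hE ⟨?_, ?_, ?_⟩ ?_ ((Finset.card_le_card ?_).trans hcard)
      · simpa using ⟨hHp, (hfam.mono ho).mem⟩
      · simpa using ⟨hHne, (hfam.mono ho).nonempty⟩
      · rw [Finset.coe_insert]
        exact (hfam.mono ho).disjoint.insert fun C hC _ => (hod C hC).symm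
      · simpa using ⟨hullIn_subset hAE, fun C hC =>
          hsub C (Finset.mem_of_mem_erase (ho hC))⟩
      · rw [Finset.filter_insert, if_neg (not_not.2 hHs.isSolid)]
        exact Finset.filter_subset_filter _ ho
    rw [Finset.sum_insert hHo, hHl] at houter
    have hdec := hlam.lambdaOne_add_tsum_holesIn hAp hAne hE hAE
    rw [← hH] at hdec
    constructor
    · refine le_trans ?_ houter.1
      rw [hsum, ← hdec, hgroup]
      gcongr with B
      exact (hhole B).1
    · intro hun
      -- When the family covers E, every hole is covered by the members inside it, since all other
      -- members are disjoint from the hole; so both induction hypotheses give equalities.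
      rw [← houter.2 ?_, hsum, ← hdec, hgroup]
      · congr 3
        ext B
        refine (hhole B).2 (Subset.antisymm (sUnion_subset fun C hC =>
          (Finset.mem_filter.1 hC).2) fun x hx => ?_)
        obtain ⟨C, hC, hxC⟩ : x ∈ ⋃₀ (𝒜 : Set (Set X)) := hun ▸ B.2.2 hx
        have hCA : C ≠ A := by
          rintro rfl
          exact subset_of_mem_componentsOf B.2.1 hx hxC
        have hCe : C ∈ 𝒜.erase A := Finset.mem_erase.2 ⟨hCA, hC⟩
        rcases hdich C hCe with ⟨B', hB', hCB'⟩ | hd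
        · have hBB' : B' = B := eq_of_mem_componentsOf hB'.1 B.2.1 ⟨x, hCB' hxC, hx⟩
          refine ⟨C, Finset.mem_filter.2 ⟨Finset.mem_filter.2 ⟨hCe, B', hB', hCB'⟩, ?_⟩, hxC⟩
          rwa [← hBB']
        · exact (disjoint_left.1 hd hxC (subset_hullIn_of_mem_holesIn B.2 hx)).elim
      · rw [Finset.coe_insert, sUnion_insert]
        refine Subset.antisymm (union_subset (hullIn_subset hAE) (sUnion_subset fun C hC =>
          hsub C (Finset.mem_of_mem_erase (ho hC)))) fun x hx => ?_
        obtain ⟨C, hC, hxC⟩ : x ∈ ⋃₀ (𝒜 : Set (Set X)) := hun ▸ hx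
        by_cases hCA : C = A
        · exact Or.inl (subset_hullIn E A (hCA ▸ hxC))
        · have hCe : C ∈ 𝒜.erase A := Finset.mem_erase.2 ⟨hCA, hC⟩
          by_cases hCi : ∃ B ∈ holesIn E A, C ⊆ B
          · obtain ⟨B, hB, hCB⟩ := hCi
            exact Or.inl (subset_hullIn_of_mem_holesIn hB (hCB hxC))
          · exact Or.inr ⟨C, Finset.mem_filter.2 ⟨hCe, hCi⟩, hxC⟩

theorem sum_lambdaOne_le {𝒜 : Finset (Set X)} {E : Set X} (hE : IsBddSolid E)
    (h𝒜 : IsDisjointFamily 𝒜) (hsub : ∀ A ∈ 𝒜, A ⊆ E) :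
    ∑ A ∈ 𝒜, lambdaOne lam A ≤ lam E := by
  classical
  exact (hlam.sum_lambdaOne_of_card_le _ hE h𝒜 hsub le_rfl).1

theorem sum_lambdaOne_eq {𝒜 : Finset (Set X)} {E : Set X} (hE : IsBddSolid E)
    (h𝒜 : IsDisjointFamily 𝒜) (hun : ⋃₀ (𝒜 : Set (Set X)) = E) :
    ∑ A ∈ 𝒜, lambdaOne lam A = lam E := by
  classical
  exact (hlam.sum_lambdaOne_of_card_le _ hE h𝒜
    (fun A hA => hun ▸ subset_sUnion_of_mem (Finset.mem_coe.2 hA)) le_rfl).2 hun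

theorem isDisjointFamily_union_holes [DecidableEq (Set X)] {𝒜 s : Finset (Set X)} {A E : Set X}
    (hA : IsBddSemisolidOrCompactConnected A) (hne : A.Nonempty) (hE : IsBddSolid E)
    (h𝒜 : IsDisjointFamily 𝒜) (hsub : ∀ C ∈ 𝒜, C ⊆ A) (hs : (s : Set (Set X)) ⊆ holesIn E A) :
    IsDisjointFamily (𝒜 ∪ s) ∧ Disjoint 𝒜 s ∧
      ∑ C ∈ s, lambdaOne lam C = ∑ C ∈ s, (lam C : ℝ≥0∞) := by
  have hd : ∀ C ∈ 𝒜, ∀ B ∈ s, Disjoint C B := fun C hC B hB =>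
    disjoint_left.2 fun x hxC hxB =>
      subset_of_mem_componentsOf (hs hB).1 hxB (hsub C hC hxC)
  have hmem : ∀ B ∈ s, IsBddSemisolidOrCompactConnected B := fun B hB =>
    hA.of_mem_componentsOf hne (hs hB).1 (hE.isBoundedSet.mono (hs hB).2)
  have hsne : ∀ B ∈ s, B.Nonempty := fun B hB => nonempty_of_mem_componentsOf (hs hB).1
  refine ⟨⟨?_, ?_, ?_⟩, ?_, ?_⟩
  · intro C hC
    exact (Finset.mem_union.1 hC).elim (h𝒜.mem C) (hmem C)
  · intro C hC
    exact (Finset.mem_union.1 hC).elim (h𝒜.nonempty C) (hsne C)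
  · rw [Finset.coe_union]
    exact h𝒜.disjoint.union ((pairwiseDisjoint_componentsOf Aᶜ).subset
      (hs.trans (holesIn_subset E A))) fun C hC B hB _ => hd C hC B hB
  · refine Finset.disjoint_left.2 fun C hC hC' => (hsne C hC').ne_empty ?_
    exact disjoint_self.1 (hd C hC C hC')
  · exact Finset.sum_congr rfl fun B hB => hlam.lambdaOne_of_isSolid (hmem B hB) (hsne B hB)
      (hA.isBddSolid_of_mem_holesIn hne hE (hs hB)).isSolid

theorem tsum_holesIn_ne_top {A E : Set X} (hA : IsBddSemisolidOrCompactConnected A)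
    (hne : A.Nonempty) (hE : IsBddSolid E) (hAE : A ⊆ E) :
    ∑' B : holesIn E A, (lam B : ℝ≥0∞) ≠ ∞ :=
  ((hlam.tsum_holesIn_le hA hne hE hAE).trans_lt ENNReal.coe_lt_top).ne

/-- Any finite set of holes of A can be adjoined to the family, inside the solid hull. Taking the
supremum over such sets and cancelling the finite total of the holes gives the bound. -/
theorem sum_lambdaOne_le_lambdaOne {𝒜 : Finset (Set X)} {A : Set X}
    (hA : IsBddSemisolidOrCompactConnected A) (hne : A.Nonempty)
    (h𝒜 : IsDisjointFamily 𝒜) (hsub : ∀ C ∈ 𝒜, C ⊆ A) :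
    ∑ C ∈ 𝒜, lambdaOne lam C ≤ lambdaOne lam A := by
  classical
  obtain ⟨E, hE, hAE⟩ := hA.isBoundedSet.exists_isBddSolid hne
  have hfin := hlam.tsum_holesIn_ne_top hA hne hE hAE
  refine ENNReal.le_of_add_le_add_right hfin ?_
  rw [hlam.lambdaOne_add_tsum_holesIn hA hne hE hAE, ENNReal.tsum_eq_iSup_sum, ENNReal.add_iSup]
  refine iSup_le fun s => ?_
  have hs : ((s.map (Function.Embedding.subtype _) : Finset (Set X)) : Set (Set X)) ⊆
      holesIn E A := by
    intro B hB
    obtain ⟨B', -, rfl⟩ := Finset.mem_map.1 (Finset.mem_coe.1 hB)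
    exact B'.2
  obtain ⟨h1, h2, h3⟩ := hlam.isDisjointFamily_union_holes hA hne hE h𝒜 hsub hs
  have h4 := hlam.sum_lambdaOne_le (hA.isBddSolid_hullIn hne hE hAE) h1 fun C hC =>
    (Finset.mem_union.1 hC).elim (fun h => (hsub C h).trans (subset_hullIn E A))
      fun h => subset_hullIn_of_mem_holesIn (hs h)
  rw [Finset.sum_union h2, h3, Finset.sum_map] at h4
  exact h4

/-- Finiteness of the number of components lets all holes be adjoined at once, which turns the
family into a finite partition of the hull. -/
theorem sum_lambdaOne_eq_lambdaOne {𝒜 : Finset (Set X)} {A : Set X}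
    (hA : IsBddSemisolidOrCompactConnected A) (hne : A.Nonempty) (hc : (componentsOf Aᶜ).Finite)
    (h𝒜 : IsDisjointFamily 𝒜) (hun : ⋃₀ (𝒜 : Set (Set X)) = A) :
    ∑ C ∈ 𝒜, lambdaOne lam C = lambdaOne lam A := by
  classical
  obtain ⟨E, hE, hAE⟩ := hA.isBoundedSet.exists_isBddSolid hne
  have hfin := hlam.tsum_holesIn_ne_top hA hne hE hAE
  have hdec := hlam.lambdaOne_add_tsum_holesIn hA hne hE hAE
  have hhf : (holesIn E A).Finite := hc.subset (holesIn_subset E A)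
  lift holesIn E A to Finset (Set X) using hhf with s hs
  obtain ⟨h1, h2, h3⟩ := hlam.isDisjointFamily_union_holes hA hne hE h𝒜
    (fun C hC => hun ▸ subset_sUnion_of_mem (Finset.mem_coe.2 hC)) hs.le
  have h4 := hlam.sum_lambdaOne_eq (hA.isBddSolid_hullIn hne hE hAE) h1
    (by rw [Finset.coe_union, sUnion_union, hun, hs, hullIn])
  rw [Finset.sum_union h2, h3, ← hdec] at h4
  have h5 : ∑' B : (s : Set (Set X)), (lam B : ℝ≥0∞) = ∑ B ∈ s, (lam B : ℝ≥0∞) :=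
    Finset.tsum_subtype' s fun B => (lam B : ℝ≥0∞)
  rw [hs] at h5
  rw [h5] at h4 hfin
  exact (ENNReal.add_left_inj hfin).1 h4

end IsSolidSetFunction

end Partitions

/-! ### The extension and its additivity. -/

section Extension

open Set Topology

variable {X : Type*} [TopologicalSpace X]

/-- Finite disjoint families of nonempty compact connected sets. -/
structure IsCompactFamily (𝒞 : Finset (Set X)) : Prop where
  isCompact : ∀ C ∈ 𝒞, IsCompact C
  isPreconnected : ∀ C ∈ 𝒞, IsPreconnected C
  nonempty : ∀ C ∈ 𝒞, C.Nonempty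
  disjoint : (𝒞 : Set (Set X)).PairwiseDisjoint id

namespace IsCompactFamily

theorem isDisjointFamily {𝒞 : Finset (Set X)} (h : IsCompactFamily 𝒞) : IsDisjointFamily 𝒞 :=
  ⟨fun C hC => .of_isCompact (h.isCompact C hC) (h.isPreconnected C hC), h.nonempty, h.disjoint⟩

theorem mono {𝒞 𝒟 : Finset (Set X)} (h : IsCompactFamily 𝒟) (hs : 𝒞 ⊆ 𝒟) : IsCompactFamily 𝒞 :=
  ⟨fun C hC => h.isCompact C (hs hC), fun C hC => h.isPreconnected C (hs hC),
    fun C hC => h.nonempty C (hs hC), h.disjoint.subset (Finset.coe_subset.2 hs)⟩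

theorem empty : IsCompactFamily (∅ : Finset (Set X)) :=
  ⟨by simp, by simp, by simp, by simp⟩

theorem isCompact_sUnion {𝒞 : Finset (Set X)} (h : IsCompactFamily 𝒞) :
    IsCompact (⋃₀ (𝒞 : Set (Set X))) := by
  rw [sUnion_eq_biUnion]
  exact 𝒞.isCompact_biUnion h.isCompact

theorem of_componentsOf [T2Space X] {Q : Set X} (hQ : IsCompact Q)
    (hfin : (componentsOf Q).Finite) : IsCompactFamily hfin.toFinset := by
  refine ⟨fun C hC => ?_, fun C hC => ?_, fun C hC => ?_, ?_⟩
  · rw [hfin.mem_toFinset] at hC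
    exact hQ.of_isClosed_subset (isClosed_of_mem_componentsOf hQ.isClosed hC)
      (subset_of_mem_componentsOf hC)
  · exact isPreconnected_of_mem_componentsOf (hfin.mem_toFinset.1 hC)
  · exact nonempty_of_mem_componentsOf (hfin.mem_toFinset.1 hC)
  · rw [hfin.coe_toFinset]
    exact pairwiseDisjoint_componentsOf Q

end IsCompactFamily

/-- The inner approximation of the extension by finite unions of disjoint compact connected
sets. -/
noncomputable def innerValue (lam : Set X → ℝ≥0) (U : Set X) : ℝ≥0∞ :=
  ⨆ 𝒞 ∈ {𝒞 : Finset (Set X) | IsCompactFamily 𝒞 ∧ ∀ C ∈ 𝒞, C ⊆ U}, ∑ C ∈ 𝒞, lambdaOne lam C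

/-- The extension of a solid-set function. -/
noncomputable def solidExtension (lam : Set X → ℝ≥0) (A : Set X) : ℝ≥0∞ :=
  ⨅ U ∈ {U : Set X | IsOpen U ∧ A ⊆ U}, innerValue lam U

section Basic

variable {lam : Set X → ℝ≥0} {U V A B : Set X}

theorem sum_le_innerValue {𝒞 : Finset (Set X)} (h : IsCompactFamily 𝒞) (hU : ∀ C ∈ 𝒞, C ⊆ U) :
    ∑ C ∈ 𝒞, lambdaOne lam C ≤ innerValue lam U :=
  le_iSup₂_of_le (f := fun 𝒞 _ => ∑ C ∈ 𝒞, lambdaOne lam C) 𝒞 ⟨h, hU⟩ le_rfl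

theorem innerValue_le {a : ℝ≥0∞} (h : ∀ 𝒞 : Finset (Set X), IsCompactFamily 𝒞 →
    (∀ C ∈ 𝒞, C ⊆ U) → ∑ C ∈ 𝒞, lambdaOne lam C ≤ a) : innerValue lam U ≤ a :=
  iSup₂_le fun 𝒞 h𝒞 => h 𝒞 h𝒞.1 h𝒞.2

theorem innerValue_mono (h : U ⊆ V) : innerValue lam U ≤ innerValue lam V :=
  innerValue_le fun _ h𝒞 hU => sum_le_innerValue h𝒞 fun C hC => (hU C hC).trans h

theorem innerValue_empty : innerValue lam (∅ : Set X) = 0 := by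
  refine le_antisymm (innerValue_le fun 𝒞 h𝒞 hU => ?_) zero_le
  rw [Finset.sum_eq_zero]
  exact fun C hC => ((h𝒞.nonempty C hC).ne_empty (subset_empty_iff.1 (hU C hC))).elim

theorem solidExtension_le (hU : IsOpen U) (h : A ⊆ U) :
    solidExtension lam A ≤ innerValue lam U :=
  iInf₂_le U ⟨hU, h⟩

theorem solidExtension_mono (h : A ⊆ B) : solidExtension lam A ≤ solidExtension lam B :=
  le_iInf₂ fun _ hU => solidExtension_le hU.1 (h.trans hU.2)

theorem solidExtension_of_isOpen (hU : IsOpen U) :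
    solidExtension lam U = innerValue lam U :=
  (solidExtension_le hU le_rfl).antisymm (le_iInf₂ fun _ hV => innerValue_mono hV.2)

theorem le_solidExtension_add {a : ℝ≥0∞} (h : ∀ U V : Set X, IsOpen U → A ⊆ U → IsOpen V →
    B ⊆ V → a ≤ innerValue lam U + innerValue lam V) :
    a ≤ solidExtension lam A + solidExtension lam B := by
  simp only [solidExtension, ENNReal.iInf_add, ENNReal.add_iInf]
  exact le_iInf₂ fun V hV => le_iInf₂ fun U hU => h U V hU.1 hU.2 hV.1 hV.2

/-- A connected set contained in a disjoint union of two open sets lies in one of them, so each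
competing family splits. -/
theorem innerValue_union (hU : IsOpen U) (hV : IsOpen V) (hd : Disjoint U V) :
    innerValue lam (U ∪ V) = innerValue lam U + innerValue lam V := by
  classical
  refine le_antisymm (innerValue_le fun 𝒞 h𝒞 hs => ?_) ?_
  · rw [← Finset.sum_filter_add_sum_filter_not 𝒞 (fun C => C ⊆ U)]
    refine add_le_add (sum_le_innerValue (h𝒞.mono (Finset.filter_subset _ _))
      fun C hC => (Finset.mem_filter.1 hC).2)
      (sum_le_innerValue (h𝒞.mono (Finset.filter_subset _ _)) fun C hC => ?_)
    rw [Finset.mem_filter] at hC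
    refine (isPreconnected_iff_subset_of_disjoint.1 (h𝒞.isPreconnected C hC.1) U V hU hV
      (hs C hC.1) ?_).resolve_left hC.2
    rw [hd.inter_eq, inter_empty]
  · refine ENNReal.biSup_add_biSup_le' ⟨∅, .empty, by simp⟩ ⟨∅, .empty, by simp⟩ ?_
    rintro 𝒞 ⟨h𝒞, h𝒞U⟩ 𝒟 ⟨h𝒟, h𝒟V⟩
    have hCD : ∀ C ∈ 𝒞, ∀ D ∈ 𝒟, Disjoint C D := fun C hC D hD =>
      hd.mono (h𝒞U C hC) (h𝒟V D hD)
    rw [← Finset.sum_union (Finset.disjoint_left.2 fun C hC hC' =>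
      (h𝒞.nonempty C hC).ne_empty (disjoint_self.1 (hCD C hC C hC')))]
    refine sum_le_innerValue ⟨?_, ?_, ?_, ?_⟩ ?_
    · exact fun C hC => (Finset.mem_union.1 hC).elim (h𝒞.isCompact C) (h𝒟.isCompact C)
    · exact fun C hC => (Finset.mem_union.1 hC).elim (h𝒞.isPreconnected C) (h𝒟.isPreconnected C)
    · exact fun C hC => (Finset.mem_union.1 hC).elim (h𝒞.nonempty C) (h𝒟.nonempty C)
    · rw [Finset.coe_union]
      exact h𝒞.disjoint.union h𝒟.disjoint fun C hC D hD _ => hCD C hC D hD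
    · exact fun C hC => (Finset.mem_union.1 hC).elim
        (fun h => (h𝒞U C h).trans subset_union_left) fun h => (h𝒟V C h).trans subset_union_right

variable [T2Space X]

/-- The easy half of mixed additivity: a compact family inside U is separated from A by disjoint
open sets, and additivity on open sets applies. -/
theorem solidExtension_add_innerValue_le (hA : IsCompact A) (hV : IsOpen V) (hAV : A ⊆ V)
    (hUV : U ⊆ V) (hd : Disjoint A U) :
    solidExtension lam A + innerValue lam U ≤ innerValue lam V := by
  rw [innerValue, ENNReal.add_biSup' ⟨∅, .empty, by simp⟩]
  refine iSup₂_le fun 𝒞 h𝒞 => ?_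
  have hsub : ⋃₀ (𝒞 : Set (Set X)) ⊆ U := sUnion_subset h𝒞.2
  obtain ⟨S, T, hS, hT, hAS, h𝒞T, hST⟩ := SeparatedNhds.of_isCompact_isCompact hA
    h𝒞.1.isCompact_sUnion (hd.mono_right hsub)
  calc solidExtension lam A + ∑ C ∈ 𝒞, lambdaOne lam C
      ≤ innerValue lam (S ∩ V) + innerValue lam (T ∩ V) := add_le_add
        (solidExtension_le (hS.inter hV) (subset_inter hAS hAV))
        (sum_le_innerValue h𝒞.1 fun C hC => subset_inter
          ((subset_sUnion_of_mem (Finset.mem_coe.2 hC)).trans h𝒞T) ((h𝒞.2 C hC).trans hUV))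
    _ = innerValue lam (S ∩ V ∪ T ∩ V) := (innerValue_union (hS.inter hV) (hT.inter hV)
        (hST.mono inter_subset_left inter_subset_left)).symm
    _ ≤ innerValue lam V := innerValue_mono (union_subset inter_subset_right inter_subset_right)

theorem solidExtension_union_of_isCompact (hA : IsCompact A) (hB : IsCompact B)
    (hd : Disjoint A B) :
    solidExtension lam (A ∪ B) = solidExtension lam A + solidExtension lam B := by
  obtain ⟨S, T, hS, hT, hAS, hBT, hST⟩ := SeparatedNhds.of_isCompact_isCompact hA hB hd
  refine le_antisymm (le_solidExtension_add fun U V hU hAU hV hBV => ?_)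
    (le_iInf₂ fun W hW => ?_)
  · calc solidExtension lam (A ∪ B) ≤ innerValue lam (U ∩ S ∪ V ∩ T) :=
          solidExtension_le ((hU.inter hS).union (hV.inter hT))
            (union_subset_union (subset_inter hAU hAS) (subset_inter hBV hBT))
      _ = innerValue lam (U ∩ S) + innerValue lam (V ∩ T) :=
          innerValue_union (hU.inter hS) (hV.inter hT)
            (hST.mono inter_subset_right inter_subset_right)
      _ ≤ innerValue lam U + innerValue lam V :=
          add_le_add (innerValue_mono inter_subset_left) (innerValue_mono inter_subset_left)
  · calc solidExtension lam A + solidExtension lam B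
        ≤ innerValue lam (W ∩ S) + innerValue lam (W ∩ T) := add_le_add
          (solidExtension_le (hW.1.inter hS) (subset_inter (subset_union_left.trans hW.2) hAS))
          (solidExtension_le (hW.1.inter hT) (subset_inter (subset_union_right.trans hW.2) hBT))
      _ = innerValue lam (W ∩ S ∪ W ∩ T) := (innerValue_union (hW.1.inter hS) (hW.1.inter hT)
          (hST.mono inter_subset_right inter_subset_right)).symm
      _ ≤ innerValue lam W := innerValue_mono (union_subset inter_subset_left inter_subset_left)

end Basic

theorem finite_componentsOf_compl_of_mem_componentsOf {S B : Set X}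
    (hS : (componentsOf S).Finite) (hSc : (componentsOf Sᶜ).Finite) (hB : B ∈ componentsOf S) :
    (componentsOf Bᶜ).Finite := by
  have h1 := compl_union_sUnion_componentsOf (A := Sᶜ) (ℬ := componentsOf S \ {B})
    (by rw [compl_compl]; exact sdiff_subset)
  rw [compl_compl, sdiff_sdiff_eq_self (singleton_subset_iff.2 hB), sUnion_singleton] at h1
  rw [← h1, compl_compl]
  refine finite_componentsOf_union hSc ?_
  rw [componentsOf_sUnion_of_subset sdiff_subset]
  exact hS.subset sdiff_subset

theorem isBddSemisolidOrCompactConnected_of_mem_componentsOf [LocallyConnectedSpace X]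
    {S B : Set X} (hSo : IsOpen S) (hSb : IsBoundedSet S) (hS : (componentsOf S).Finite)
    (hSc : (componentsOf Sᶜ).Finite) (hB : B ∈ componentsOf S) :
    IsBddSemisolidOrCompactConnected B :=
  Or.inr (Or.inl ⟨isOpen_of_mem_componentsOf hSo hB, hSb.mono (subset_of_mem_componentsOf hB),
    isPreconnected_of_mem_componentsOf hB,
    finite_componentsOf_compl_of_mem_componentsOf hS hSc hB⟩)

variable [PreconnectedSpace X] [LocallyConnectedSpace X] [T2Space X] [LocallyCompactSpace X]

namespace IsSolidSetFunction

variable {lam : Set X → ℝ≥0} (hlam : IsSolidSetFunction lam)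
include hlam

/-- `innerValue` tests compact families only, but here the pieces may be open. They are grouped
inside the components of R, and superadditivity replaces each group by its component. -/
theorem sum_lambdaOne_le_innerValue {𝒟 : Finset (Set X)} {R U : Set X}
    (h𝒟 : IsDisjointFamily 𝒟) (hR : IsCompact R) (hfin : (componentsOf R).Finite) (hRU : R ⊆ U)
    (hsub : ∀ P ∈ 𝒟, P ⊆ R) : ∑ P ∈ 𝒟, lambdaOne lam P ≤ innerValue lam U := by
  classical
  have hfam := IsCompactFamily.of_componentsOf hR hfin
  have hmem : ∀ C, C ∈ hfin.toFinset ↔ C ∈ componentsOf R := fun C => hfin.mem_toFinset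
  calc ∑ P ∈ 𝒟, lambdaOne lam P
      = ∑' C : componentsOf R, ∑ P ∈ 𝒟 with P ⊆ (C : Set X), lambdaOne lam P :=
        sum_eq_tsum_sum_filter_subset _ (pairwiseDisjoint_componentsOf R) h𝒟.nonempty
          fun P hP => exists_component_superset (h𝒟.mem P hP).isPreconnected (hsub P hP)
            (h𝒟.nonempty P hP)
    _ ≤ ∑' C : componentsOf R, lambdaOne lam (C : Set X) :=
        ENNReal.tsum_le_tsum fun C => hlam.sum_lambdaOne_le_lambdaOne
          (hfam.isDisjointFamily.mem C ((hmem C).2 C.2)) (nonempty_of_mem_componentsOf C.2)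
          (h𝒟.mono (Finset.filter_subset _ _)) fun P hP => (Finset.mem_filter.1 hP).2
    _ = ∑ C ∈ hfin.toFinset, lambdaOne lam C := by
        rw [← Finset.tsum_subtype' hfin.toFinset, hfin.coe_toFinset]
    _ ≤ innerValue lam U := sum_le_innerValue hfam fun C hC =>
        (subset_of_mem_componentsOf ((hmem C).1 hC)).trans hRU

/-- The hard half of mixed additivity. A competing family in V is grouped in the components of the
complement of Z, and these are cut into components of Q, which lie in W, and components of the gap,
which avoid K. -/
theorem innerValue_le_add_sdiff {K W V : Set X} (hK : IsCompact K) (hW : IsOpen W)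
    (hV : IsOpen V) (hKW : K ⊆ W) (hWV : W ⊆ V) :
    innerValue lam V ≤ innerValue lam W + innerValue lam (V \ K) := by
  classical
  rcases K.eq_empty_or_nonempty with rfl | hKne
  · rw [sdiff_empty]
    exact le_add_self
  refine innerValue_le fun 𝒞 h𝒞 h𝒞V => ?_
  obtain ⟨Q, Z, N, hQ, hKQ, hQW, hZ, hQZ, h𝒞Z, hN, hNV, hZN, hQf, hZf, hQZf⟩ :=
    exists_separation hK hKne h𝒞.isCompact_sUnion hW hV hKW hWV (sUnion_subset h𝒞V)
  have hSo : IsOpen (Q ∪ Z)ᶜ := (hQ.isClosed.union hZ).isOpen_compl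
  have hZc : Zᶜ = Q ∪ (Q ∪ Z)ᶜ := by
    ext x
    have : x ∈ Q → x ∉ Z := fun h => disjoint_left.1 hQZ h
    simp only [mem_compl_iff, mem_union]
    tauto
  have hSZ : (Q ∪ Z)ᶜ ⊆ Zᶜ := compl_subset_compl.2 subset_union_right
  have hNb := isBoundedSet_of_isCompact hN
  have hGf : (componentsOf Zᶜ).Finite := by
    rw [hZc]
    exact finite_componentsOf_union hQf hQZf
  have hPp : ∀ P ∈ componentsOf (Q ∪ Z)ᶜ, IsBddSemisolidOrCompactConnected P := fun P hP =>
    isBddSemisolidOrCompactConnected_of_mem_componentsOf hSo (hNb.mono (hSZ.trans hZN)) hQZf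
      (by rw [compl_compl]; exact finite_componentsOf_union hQf hZf) hP
  have hGp : ∀ G ∈ componentsOf Zᶜ, IsBddSemisolidOrCompactConnected G := fun G hG =>
    isBddSemisolidOrCompactConnected_of_mem_componentsOf hZ.isOpen_compl (hNb.mono hZN) hGf
      (by rwa [compl_compl]) hG
  have h𝒬 := IsCompactFamily.of_componentsOf hQ hQf
  have hQP : ∀ C ∈ componentsOf Q, ∀ P ∈ componentsOf (Q ∪ Z)ᶜ, Disjoint C P :=
    fun C hC P hP => disjoint_left.2 fun x hxC hxP => subset_of_mem_componentsOf hP hxP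
      (Or.inl (subset_of_mem_componentsOf hC hxC))
  have h𝒟 : IsDisjointFamily hQZf.toFinset := by
    refine ⟨fun P hP => hPp P (hQZf.mem_toFinset.1 hP),
      fun P hP => nonempty_of_mem_componentsOf (hQZf.mem_toFinset.1 hP), ?_⟩
    rw [hQZf.coe_toFinset]
    exact pairwiseDisjoint_componentsOf _
  have hdisj : Disjoint hQf.toFinset hQZf.toFinset := by
    refine Finset.disjoint_left.2 fun C hC hC' => (h𝒬.nonempty C hC).ne_empty ?_
    exact disjoint_self.1 (hQP C (hQf.mem_toFinset.1 hC) C (hQZf.mem_toFinset.1 hC'))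
  set 𝒜 := hQf.toFinset ∪ hQZf.toFinset with h𝒜def
  have h𝒜mem : ∀ A, A ∈ 𝒜 ↔ A ∈ componentsOf Q ∨ A ∈ componentsOf (Q ∪ Z)ᶜ := by
    simp [h𝒜def]
  have h𝒜 : IsDisjointFamily 𝒜 := by
    refine ⟨fun A hA => ?_, fun A hA => ?_, ?_⟩
    · exact (Finset.mem_union.1 hA).elim (h𝒬.isDisjointFamily.mem A) (h𝒟.mem A)
    · exact (Finset.mem_union.1 hA).elim (h𝒬.nonempty A) (h𝒟.nonempty A)
    · rw [h𝒜def, Finset.coe_union]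
      refine h𝒬.disjoint.union h𝒟.disjoint fun C hC P hP _ => hQP C ?_ P ?_
      · exact hQf.mem_toFinset.1 hC
      · exact hQZf.mem_toFinset.1 hP
  have h𝒜Z : ∀ A ∈ 𝒜, A ⊆ Zᶜ := fun A hA => by
    rw [hZc]
    exact ((h𝒜mem A).1 hA).elim (fun h => (subset_of_mem_componentsOf h).trans subset_union_left)
      fun h => (subset_of_mem_componentsOf h).trans subset_union_right
  have hunion : ∀ G : componentsOf Zᶜ,
      ⋃₀ (({A ∈ 𝒜 | A ⊆ (G : Set X)} : Finset (Set X)) : Set (Set X)) = (G : Set X) := by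
    intro G
    refine Subset.antisymm (sUnion_subset fun A hA => (Finset.mem_filter.1 hA).2) fun x hx => ?_
    obtain ⟨A, hA, hxA⟩ : ∃ A ∈ 𝒜, x ∈ A := by
      have hxZ := subset_of_mem_componentsOf G.2 hx
      rw [hZc] at hxZ
      rcases hxZ with h | h
      · obtain ⟨A, hA, hxA⟩ := exists_mem_componentsOf_mem h
        exact ⟨A, (h𝒜mem A).2 (Or.inl hA), hxA⟩
      · obtain ⟨A, hA, hxA⟩ := exists_mem_componentsOf_mem h
        exact ⟨A, (h𝒜mem A).2 (Or.inr hA), hxA⟩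
    exact ⟨A, Finset.mem_filter.2 ⟨hA, subset_component_of_inter_nonempty G.2
      (h𝒜.mem A hA).isPreconnected (h𝒜Z A hA) ⟨x, hxA, hx⟩⟩, hxA⟩
  -- The gap pieces all lie in `N \ interior Q`, a compact subset of V \ K; R enlarges it to a
  -- compact set with finitely many components.
  obtain ⟨R, hR, hRN, hRV, hRf⟩ := exists_compact_finite_componentsOf
    (hN.diff (isOpen_interior (s := Q))) (hV.sdiff hK.isClosed)
    fun x hx => ⟨hNV hx.1, fun hxK => hx.2 (hKQ hxK)⟩
  calc ∑ C ∈ 𝒞, lambdaOne lam C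
      = ∑' G : componentsOf Zᶜ, ∑ C ∈ 𝒞 with C ⊆ (G : Set X), lambdaOne lam C :=
        sum_eq_tsum_sum_filter_subset _ (pairwiseDisjoint_componentsOf Zᶜ) h𝒞.nonempty
          fun C hC => exists_component_superset (h𝒞.isPreconnected C hC)
            (subset_compl_iff_disjoint_right.2
              (h𝒞Z.mono_left (subset_sUnion_of_mem (Finset.mem_coe.2 hC)))) (h𝒞.nonempty C hC)
    _ ≤ ∑' G : componentsOf Zᶜ, lambdaOne lam (G : Set X) :=
        ENNReal.tsum_le_tsum fun G => hlam.sum_lambdaOne_le_lambdaOne (hGp G G.2)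
          (nonempty_of_mem_componentsOf G.2)
          (h𝒞.isDisjointFamily.mono (Finset.filter_subset _ _))
          fun C hC => (Finset.mem_filter.1 hC).2
    _ = ∑' G : componentsOf Zᶜ, ∑ A ∈ 𝒜 with A ⊆ (G : Set X), lambdaOne lam A :=
        tsum_congr fun G => (hlam.sum_lambdaOne_eq_lambdaOne (hGp G G.2)
          (nonempty_of_mem_componentsOf G.2)
          (finite_componentsOf_compl_of_mem_componentsOf hGf (by rwa [compl_compl]) G.2)
          (h𝒜.mono (Finset.filter_subset _ _)) (hunion G)).symm
    _ = ∑ A ∈ 𝒜, lambdaOne lam A :=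
        (sum_eq_tsum_sum_filter_subset _ (pairwiseDisjoint_componentsOf Zᶜ) h𝒜.nonempty
          fun A hA => exists_component_superset (h𝒜.mem A hA).isPreconnected (h𝒜Z A hA)
            (h𝒜.nonempty A hA)).symm
    _ = ∑ C ∈ hQf.toFinset, lambdaOne lam C + ∑ P ∈ hQZf.toFinset, lambdaOne lam P :=
        Finset.sum_union hdisj
    _ ≤ innerValue lam W + innerValue lam (V \ K) := by
        refine add_le_add (sum_le_innerValue h𝒬 fun C hC =>
          (subset_of_mem_componentsOf (hQf.mem_toFinset.1 hC)).trans hQW)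
          (hlam.sum_lambdaOne_le_innerValue h𝒟 hR hRf hRV fun P hP x hx => ?_)
        have hxS := subset_of_mem_componentsOf (hQZf.mem_toFinset.1 hP) hx
        exact interior_subset (hRN ⟨hZN (hSZ hxS), fun hxQ => hxS (Or.inl (interior_subset hxQ))⟩)

theorem solidExtension_union_of_isOpen {K U : Set X} (hK : IsCompact K)
    (hKU : IsOpen (K ∪ U)) (hd : Disjoint K U) :
    solidExtension lam (K ∪ U) = solidExtension lam K + innerValue lam U := by
  refine le_antisymm ?_ ?_
  · rw [solidExtension_of_isOpen hKU, solidExtension, ENNReal.iInf_add]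
    simp only [ENNReal.iInf_add]
    refine le_iInf₂ fun W hW => ?_
    have h := hlam.innerValue_le_add_sdiff hK (hW.1.inter hKU) hKU
      (subset_inter hW.2 subset_union_left) inter_subset_right
    rw [union_sdiff_left, hd.symm.sdiff_eq_left] at h
    exact h.trans (by gcongr; exact innerValue_mono inter_subset_left)
  · rw [solidExtension_of_isOpen hKU]
    exact solidExtension_add_innerValue_le hK hKU subset_union_left subset_union_right hd

theorem solidExtension_union_of_isCompact_union {K U : Set X} (hK : IsCompact K) (hU : IsOpen U)
    (hKU : IsCompact (K ∪ U)) (hd : Disjoint K U) :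
    solidExtension lam (K ∪ U) = solidExtension lam K + innerValue lam U := by
  refine le_antisymm ?_ (le_iInf₂ fun W hW => solidExtension_add_innerValue_le hK hW.1
    (subset_union_left.trans hW.2) (subset_union_right.trans hW.2) hd)
  conv_rhs => rw [solidExtension]
  simp only [ENNReal.iInf_add]
  refine le_iInf₂ fun V hV => ?_
  -- The part of the compact union outside V lies in U and is the compact set to remove: what
  -- remains of V ∪ U is contained in V.
  have hM : (K ∪ U) \ V ⊆ U := fun x hx => hx.1.resolve_left fun h => hx.2 (hV.2 h)
  calc solidExtension lam (K ∪ U) ≤ innerValue lam (V ∪ U) :=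
        solidExtension_le (hV.1.union hU) (union_subset_union_left U hV.2)
    _ ≤ innerValue lam U + innerValue lam ((V ∪ U) \ ((K ∪ U) \ V)) :=
        hlam.innerValue_le_add_sdiff (hKU.diff hV.1) hU (hV.1.union hU) hM subset_union_right
    _ ≤ innerValue lam V + innerValue lam U := by
        rw [add_comm]
        gcongr
        refine innerValue_mono fun x hx => ?_
        by_contra hxV
        exact hx.2 ⟨Or.inr (hx.1.resolve_left hxV), hxV⟩

end IsSolidSetFunction

end Extension

/-! ### Uniqueness: the values forced on a topological measure. -/

section Uniqueness

open Set Topology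

variable {X : Type*} [TopologicalSpace X]

/-- The empty set escapes the lemmas on nonempty A. In a nonempty compact space its solid hull is
the whole space, which is also its only hole; otherwise both sides vanish. -/
theorem solidHull_empty_eq [PreconnectedSpace X] {lam : Set X → ℝ≥0} (h0 : lam ∅ = 0) :
    (lam (solidHull ∅) : ℝ≥0∞) = holesSum lam ∅ := by
  have hsub : boundedComponentsOf (∅ : Set X)ᶜ ⊆ {univ} := by
    rintro B ⟨hB, -⟩
    obtain ⟨x, hx⟩ := nonempty_of_mem_componentsOf hB
    exact univ_subset_iff.1 (subset_component_of_inter_nonempty hB isPreconnected_univ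
      (by rw [compl_empty]) ⟨x, mem_univ x, hx⟩)
  rcases subset_singleton_iff_eq.1 hsub with h | h
  · rw [solidHull, holesSum, h]
    simp [h0]
  · rw [solidHull, holesSum, h]
    simp

theorem lambdaOne_empty [PreconnectedSpace X] {lam : Set X → ℝ≥0} (h0 : lam ∅ = 0) :
    lambdaOne lam ∅ = 0 := by
  rw [lambdaOne, solidHull_empty_eq h0, tsub_self]

/-- The members are the components of their union, hence determined by it; so the sum depends on the
union only. -/
theorem IsCompactFamily.lambdaTwo_sUnion [T2Space X] {𝒞 : Finset (Set X)} (h : IsCompactFamily 𝒞)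
    (lam : Set X → ℝ≥0) :
    lambdaTwo lam (⋃₀ (𝒞 : Set (Set X))) = ∑ C ∈ 𝒞, lambdaOne lam C := by
  rw [lambdaTwo, componentsOf_sUnion_of_isClosed 𝒞.finite_toSet
    (fun C hC => (h.isCompact C hC).isClosed) h.isPreconnected h.nonempty h.disjoint]
  exact Finset.tsum_subtype' 𝒞 fun C => lambdaOne lam C

theorem IsCompactFamily.isKZero {𝒞 : Finset (Set X)} (h : IsCompactFamily 𝒞) :
    IsKZero (⋃₀ (𝒞 : Set (Set X))) := by
  refine ⟨𝒞.card, fun i => 𝒞.equivFin.symm i, fun i => ⟨h.isCompact _ (𝒞.equivFin.symm i).2,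
    h.isPreconnected _ (𝒞.equivFin.symm i).2⟩, fun i j hij => h.disjoint (𝒞.equivFin.symm i).2
    (𝒞.equivFin.symm j).2 fun h => hij (𝒞.equivFin.symm.injective (Subtype.ext h)), ?_⟩
  rw [𝒞.equivFin.symm.surjective.iUnion_comp fun C : 𝒞 => (C : Set X)]
  exact sUnion_eq_iUnion

/-- A finite disjoint union of compact connected sets, with its empty members removed. -/
theorem exists_isCompactFamily {n : ℕ} {C : Fin n → Set X}
    (hC : ∀ i, IsCompact (C i) ∧ IsPreconnected (C i)) (hd : Pairwise (Function.onFun Disjoint C)) :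
    ∃ 𝒞 : Finset (Set X), IsCompactFamily 𝒞 ∧ ⋃ i, C i = ⋃₀ (𝒞 : Set (Set X)) ∧
      ∀ f : Set X → ℝ≥0∞, f ∅ = 0 → ∑ i, f (C i) = ∑ D ∈ 𝒞, f D := by
  classical
  refine ⟨({i | (C i).Nonempty} : Finset (Fin n)).image C, ⟨?_, ?_, ?_, ?_⟩, ?_, fun f hf => ?_⟩
  · simpa using fun i _ => (hC i).1
  · simpa using fun i _ => (hC i).2
  · simp
  · rintro _ hA _ hB hAB
    obtain ⟨i, -, rfl⟩ := Finset.mem_image.1 (Finset.mem_coe.1 hA)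
    obtain ⟨j, -, rfl⟩ := Finset.mem_image.1 (Finset.mem_coe.1 hB)
    exact hd fun h => hAB (h ▸ rfl)
  · ext x
    simp only [mem_iUnion, mem_sUnion, Finset.coe_image, mem_image, exists_exists_and_eq_and,
      Finset.coe_filter, Finset.mem_univ, true_and, mem_ofPred_eq]
    exact ⟨fun ⟨i, hi⟩ => ⟨i, ⟨x, hi⟩, hi⟩, fun ⟨i, _, hi⟩ => ⟨i, hi⟩⟩
  · rw [Finset.sum_image, Finset.sum_filter_of_ne]
    · intro i _ hi
      rw [nonempty_iff_ne_empty]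
      exact fun h => hi (h ▸ hf)
    · intro i hi j _ hij
      by_contra hne
      have hdij : Disjoint (C i) (C j) := hd hne
      rw [← hij] at hdij
      exact (Finset.mem_filter.1 (Finset.mem_coe.1 hi)).2.ne_empty (disjoint_self.1 hdij)

theorem innerValue_eq_iSup_lambdaTwo [T2Space X] (lam : Set X → ℝ≥0) (U : Set X) :
    innerValue lam U = ⨆ K ∈ {K : Set X | IsKZero K ∧ K ⊆ U}, lambdaTwo lam K := by
  refine le_antisymm (innerValue_le fun 𝒞 h𝒞 hU => ?_) (iSup₂_le ?_)
  · rw [← h𝒞.lambdaTwo_sUnion]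
    exact le_iSup₂_of_le (f := fun K _ => lambdaTwo lam K) _ ⟨h𝒞.isKZero, sUnion_subset hU⟩ le_rfl
  · rintro _ ⟨⟨n, C, hC, hd, rfl⟩, hU⟩
    obtain ⟨𝒞, h𝒞, hun, -⟩ := exists_isCompactFamily hC hd
    rw [hun] at hU ⊢
    rw [h𝒞.lambdaTwo_sUnion]
    exact sum_le_innerValue h𝒞 fun D hD => (subset_sUnion_of_mem (Finset.mem_coe.2 hD)).trans hU

namespace IsTopologicalMeasure

variable {ν : Set X → ℝ≥0∞} (hν : IsTopologicalMeasure ν)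
include hν

theorem mono_of_isOpen {U V : Set X} (hU : IsOpen U) (hV : IsOpen V) (h : U ⊆ V) : ν U ≤ ν V := by
  rw [hν.inner_regular U hU, hν.inner_regular V hV]
  exact biSup_mono fun K hK => ⟨hK.1, hK.2.trans h⟩

theorem sUnion_finset (h0 : ν ∅ = 0) {s : Finset (Set X)}
    (hs : (∀ A ∈ s, IsCompact A) ∨ ∀ A ∈ s, IsOpen A) (hd : (s : Set (Set X)).PairwiseDisjoint id) :
    ν (⋃₀ (s : Set (Set X))) = ∑ A ∈ s, ν A := by
  classical
  induction s using Finset.induction_on with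
  | empty => simpa using h0
  | insert A s hA ih =>
    have hsub : ∀ B ∈ s, B ∈ insert A s := fun B hB => Finset.mem_insert_of_mem hB
    have hdA : Disjoint A (⋃₀ (s : Set (Set X))) := disjoint_sUnion_right.2 fun B hB =>
      hd (Finset.mem_coe.2 (Finset.mem_insert_self A s)) (Finset.mem_coe.2 (hsub B hB))
        fun h => hA (h ▸ hB)
    have ih' := ih (hs.imp (fun h B hB => h B (hsub B hB)) fun h B hB => h B (hsub B hB))
      (hd.subset fun B hB => Finset.mem_coe.2 (hsub B hB))
    rw [Finset.coe_insert, sUnion_insert, Finset.sum_insert hA, ← ih']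
    rcases hs with hs | hs
    · have h1 := hs A (Finset.mem_insert_self A s)
      have h2 : IsCompact (⋃₀ (s : Set (Set X))) := by
        rw [sUnion_eq_biUnion]
        exact s.isCompact_biUnion fun B hB => hs B (hsub B hB)
      exact hν.add _ _ (Or.inl h1) (Or.inl h2) (Or.inl (h1.union h2)) hdA
    · have h1 := hs A (Finset.mem_insert_self A s)
      have h2 : IsOpen (⋃₀ (s : Set (Set X))) := isOpen_sUnion fun B hB => hs B (hsub B hB)
      exact hν.add _ _ (Or.inr h1) (Or.inr h2) (Or.inr (h1.union h2)) hdA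

variable [T2Space X]

theorem le_of_isCompact_of_isOpen {K U : Set X} (hK : IsCompact K) (hU : IsOpen U) (h : K ⊆ U) :
    ν K ≤ ν U := by
  rw [hν.outer_regular K hK.isClosed]
  exact iInf₂_le U ⟨hU, h⟩

theorem mono_of_isCompact {K L : Set X} (hK : IsCompact K) (hL : IsCompact L) (h : K ⊆ L) :
    ν K ≤ ν L := by
  rw [hν.outer_regular L hL.isClosed]
  exact le_iInf₂ fun U hU => hν.le_of_isCompact_of_isOpen hK hU.1 (h.trans hU.2)

/-- Topological measures are additive on arbitrary disjoint families of open sets. -/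
theorem sUnion_of_isOpen (h0 : ν ∅ = 0) {ℬ : Set (Set X)} (hℬ : ∀ B ∈ ℬ, IsOpen B)
    (hd : ℬ.PairwiseDisjoint id) : ν (⋃₀ ℬ) = ∑' B : ℬ, ν B := by
  have hfin : ∀ s : Finset (Set X), (s : Set (Set X)) ⊆ ℬ →
      ν (⋃₀ (s : Set (Set X))) = ∑ A ∈ s, ν A := fun s hs =>
    hν.sUnion_finset h0 (Or.inr fun A hA => hℬ A (hs hA)) (hd.subset hs)
  refine le_antisymm ?_ ?_
  · rw [hν.inner_regular _ (isOpen_sUnion hℬ)]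
    refine iSup₂_le fun K hK => ?_
    obtain ⟨t, ht, htfin, hcov⟩ := hK.1.elim_finite_subcover_image (c := id) (b := ℬ) hℬ
      (by simpa only [id, ← sUnion_eq_biUnion] using hK.2)
    lift t to Finset (Set X) using htfin
    simp only [id] at hcov
    rw [← sUnion_eq_biUnion] at hcov
    calc ν K ≤ ν (⋃₀ (t : Set (Set X))) := hν.le_of_isCompact_of_isOpen hK.1
          (isOpen_sUnion fun B hB => hℬ B (ht hB)) hcov
      _ = ∑ B ∈ t, ν B := hfin t ht
      _ = ∑' B : (t : Set (Set X)), ν B := (Finset.tsum_subtype' t ν).symm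
      _ ≤ ∑' B : ℬ, ν B := ENNReal.tsum_mono_subtype ν ht
  · rw [ENNReal.tsum_eq_iSup_sum]
    refine iSup_le fun s => ?_
    have hs : ((s.map (Function.Embedding.subtype _) : Finset (Set X)) : Set (Set X)) ⊆ ℬ := by
      intro B hB
      obtain ⟨B', -, rfl⟩ := Finset.mem_map.1 (Finset.mem_coe.1 hB)
      exact B'.2
    have h := hfin _ hs
    rw [Finset.sum_map] at h
    exact h.symm.le.trans (hν.mono_of_isOpen (isOpen_sUnion fun B hB => hℬ B (hs hB))
      (isOpen_sUnion hℬ) (sUnion_subset_sUnion hs))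

variable [PreconnectedSpace X] [LocallyConnectedSpace X] [LocallyCompactSpace X]
  {lam : Set X → ℝ≥0}

/-- A compact A may have infinitely many holes, but they are open, and inner regularity gives
additivity over them. An open semisolid A has finitely many holes, all compact. In both cases the
decomposition of the hull is compared with that for `lam`, and the finite hole sum cancels. -/
theorem eq_lambdaOne (hlam : IsSolidSetFunction lam) (hext : Extends ν lam) {A : Set X}
    (hA : IsBddSemisolidOrCompactConnected A) : ν A = lambdaOne lam A := by
  have h0 : ν ∅ = 0 := by
    rw [hext ∅ (Or.inr isCompactSolid_empty), hlam.apply_empty, ENNReal.coe_zero]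
  rcases A.eq_empty_or_nonempty with rfl | hne
  · rw [h0, lambdaOne_empty hlam.apply_empty]
  obtain ⟨E, hE, hAE⟩ := hA.isBoundedSet.exists_isBddSolid hne
  have hfin := hlam.tsum_holesIn_ne_top hA hne hE hAE
  have hd : (holesIn E A).PairwiseDisjoint id :=
    (pairwiseDisjoint_componentsOf Aᶜ).subset (holesIn_subset E A)
  have hAd : Disjoint A (⋃₀ holesIn E A) := disjoint_sUnion_right.2 fun B hB =>
    (subset_compl_iff_disjoint_left.1 (subset_of_mem_componentsOf hB.1))
  have hsolid : ∀ B ∈ holesIn E A, IsBddSolid B := fun B hB =>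
    hA.isBddSolid_of_mem_holesIn hne hE hB
  have hholes : ∑' B : holesIn E A, ν B = ∑' B : holesIn E A, (lam B : ℝ≥0∞) :=
    tsum_congr fun B => hext B (hsolid B B.2)
  have hsum : ν A + ν (⋃₀ holesIn E A) = ν (hullIn E A) ∧
      ν (⋃₀ holesIn E A) = ∑' B : holesIn E A, ν B := by
    rcases isBddSemisolidOrCompactConnected_iff.1 hA with h | h
    · have hop : ∀ B ∈ holesIn E A, IsOpen B := fun B hB =>
        isOpen_of_mem_componentsOf h.1.isClosed.isOpen_compl hB.1
      exact ⟨(hν.add _ _ (Or.inl h.1) (Or.inr (isOpen_sUnion hop)) (Or.inl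
        (IsBddSemisolidOrCompactConnected.isCompactSolid_hullIn h.1 h.2 hne hE.isSolid
          hE.isBoundedSet hAE).1) hAd).symm, hν.sUnion_of_isOpen h0 hop hd⟩
    · have hcpt : ∀ B ∈ holesIn E A, IsCompact B := fun B hB => by
        have := hE.isBoundedSet.mono hB.2
        rwa [IsBoundedSet, (isClosed_of_mem_componentsOf h.1.isClosed_compl hB.1).closure_eq]
          at this
      have hf : (holesIn E A).Finite := h.2.2.2.subset (holesIn_subset E A)
      have hopen : IsOpen (hullIn E A) := by
        rw [← isClosed_compl_iff, hullIn, compl_union_sUnion_componentsOf (holesIn_subset E A)]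
        exact isClosed_sUnion_of_finite (h.2.2.2.subset sdiff_subset) fun B hB =>
          isClosed_of_mem_componentsOf h.1.isClosed_compl hB.1
      have hcu : IsCompact (⋃₀ holesIn E A) := by
        rw [sUnion_eq_biUnion]
        exact hf.isCompact_biUnion hcpt
      refine ⟨(hν.add _ _ (Or.inr h.1) (Or.inl hcu) (Or.inr hopen) hAd).symm, ?_⟩
      rw [← hf.coe_toFinset] at hd
      have h1 := hν.sUnion_finset h0 (s := hf.toFinset)
        (Or.inl fun B hB => hcpt B (hf.mem_toFinset.1 hB)) hd
      rwa [← Finset.tsum_subtype', hf.coe_toFinset] at h1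
  have hdec := hlam.lambdaOne_add_tsum_holesIn hA hne hE hAE
  rw [← hext _ (hA.isBddSolid_hullIn hne hE hAE), ← hsum.1, hsum.2, hholes] at hdec
  exact ((ENNReal.add_left_inj hfin).1 hdec).symm

theorem sUnion_isCompactFamily (hlam : IsSolidSetFunction lam) (hext : Extends ν lam)
    {𝒞 : Finset (Set X)} (h𝒞 : IsCompactFamily 𝒞) :
    ν (⋃₀ (𝒞 : Set (Set X))) = ∑ C ∈ 𝒞, lambdaOne lam C := by
  have h0 : ν ∅ = 0 := by
    rw [hext ∅ (Or.inr isCompactSolid_empty), hlam.apply_empty, ENNReal.coe_zero]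
  rw [hν.sUnion_finset h0 (Or.inl h𝒞.isCompact) h𝒞.disjoint]
  exact Finset.sum_congr rfl fun C hC => hν.eq_lambdaOne hlam hext (h𝒞.isDisjointFamily.mem C hC)

/-- Every compact subset of U lies in a compact subset with finitely many components, so such sets
suffice in inner regularity. -/
theorem eq_innerValue (hlam : IsSolidSetFunction lam) (hext : Extends ν lam) {U : Set X}
    (hU : IsOpen U) : ν U = innerValue lam U := by
  refine le_antisymm ?_ (innerValue_le fun 𝒞 h𝒞 h𝒞U => ?_)
  · rw [hν.inner_regular U hU]
    refine iSup₂_le fun K hK => ?_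
    obtain ⟨Q, hQ, hKQ, hQU, hQf⟩ := exists_compact_finite_componentsOf hK.1 hU hK.2
    have hfam := IsCompactFamily.of_componentsOf hQ hQf
    have hsum := hν.sUnion_isCompactFamily hlam hext hfam
    rw [hQf.coe_toFinset, sUnion_componentsOf] at hsum
    exact ((hν.mono_of_isCompact hK.1 hQ (hKQ.trans interior_subset)).trans hsum.le).trans
      (sum_le_innerValue hfam fun C hC =>
        (subset_of_mem_componentsOf (hQf.mem_toFinset.1 hC)).trans hQU)
  · rw [← hν.sUnion_isCompactFamily hlam hext h𝒞]
    exact hν.le_of_isCompact_of_isOpen h𝒞.isCompact_sUnion hU (sUnion_subset h𝒞U)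

theorem eq_solidExtension (hlam : IsSolidSetFunction lam) (hext : Extends ν lam) {A : Set X}
    (hA : IsOpen A ∨ IsClosed A) : ν A = solidExtension lam A := by
  rcases hA with hA | hA
  · rw [solidExtension_of_isOpen hA, hν.eq_innerValue hlam hext hA]
  · rw [hν.outer_regular A hA]
    exact iInf_congr fun U => iInf_congr fun hU => hν.eq_innerValue hlam hext hU.1

end IsTopologicalMeasure

/-! ### The extension is a compact-finite topological measure that agrees with `lam`. -/

namespace IsSolidSetFunction

variable [PreconnectedSpace X] [LocallyConnectedSpace X] [T2Space X] [LocallyCompactSpace X]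
  {lam : Set X → ℝ≥0} (hlam : IsSolidSetFunction lam)
include hlam

theorem isTopologicalMeasure_solidExtension : IsTopologicalMeasure (solidExtension lam) where
  not_identically_top := ⟨∅, Or.inl isOpen_empty, by
    rw [solidExtension_of_isOpen isOpen_empty, innerValue_empty]
    exact ENNReal.zero_ne_top⟩
  add := by
    have key : ∀ K U : Set X, IsCompact K → IsOpen U → IsCompact (K ∪ U) ∨ IsOpen (K ∪ U) →
        Disjoint K U → solidExtension lam (K ∪ U) = solidExtension lam K + solidExtension lam U := by
      rintro K U hK hU (h | h) hd
      · rw [solidExtension_of_isOpen hU, hlam.solidExtension_union_of_isCompact_union hK hU h hd]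
      · rw [solidExtension_of_isOpen hU, hlam.solidExtension_union_of_isOpen hK h hd]
    rintro A B (hA | hA) (hB | hB) hAB hd
    · exact solidExtension_union_of_isCompact hA hB hd
    · exact key A B hA hB hAB hd
    · rw [union_comm, add_comm]
      rw [union_comm] at hAB
      exact key B A hB hA hAB hd.symm
    · rw [solidExtension_of_isOpen hA, solidExtension_of_isOpen hB,
        solidExtension_of_isOpen (hA.union hB), innerValue_union hA hB hd]
  inner_regular U hU := by
    refine le_antisymm ?_ (iSup₂_le fun K hK => solidExtension_mono hK.2)
    rw [solidExtension_of_isOpen hU]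
    refine innerValue_le fun 𝒞 h𝒞 h𝒞U => ?_
    refine le_iSup₂_of_le (f := fun K _ => solidExtension lam K) (⋃₀ (𝒞 : Set (Set X)))
      ⟨h𝒞.isCompact_sUnion, sUnion_subset h𝒞U⟩ (le_iInf₂ fun V hV => ?_)
    exact sum_le_innerValue h𝒞 fun C hC =>
      (subset_sUnion_of_mem (Finset.mem_coe.2 hC)).trans hV.2
  outer_regular _ _ :=
    iInf_congr fun _ => iInf_congr fun hU => (solidExtension_of_isOpen hU.1).symm

theorem le_innerValue_of_isCompactSolid {K U : Set X} (hK : IsCompactSolid K) (hKU : K ⊆ U) :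
    (lam K : ℝ≥0∞) ≤ innerValue lam U := by
  rcases K.eq_empty_or_nonempty with rfl | hne
  · simp [hlam.apply_empty]
  · have h := sum_le_innerValue (lam := lam) (𝒞 := {K}) (U := U)
      ⟨by simpa using hK.1, by simpa using hK.2.1, by simpa using hne, by simp⟩ (by simpa using hKU)
    rwa [Finset.sum_singleton,
      hlam.lambdaOne_of_isSolid (.of_isCompact hK.1 hK.2.1) hne hK.2] at h

/-- One inequality is superadditivity inside U, the other is inner regularity of `lam` on compact
solid sets. -/
theorem innerValue_of_isBddOpenSolid {U : Set X} (hU : IsBddOpenSolid U) :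
    innerValue lam U = lam U := by
  refine le_antisymm (innerValue_le fun 𝒞 h𝒞 h𝒞U =>
    hlam.sum_lambdaOne_le (Or.inl hU) h𝒞.isDisjointFamily h𝒞U) ?_
  refine ENNReal.le_of_forall_pos_le_add fun ε hε _ => ?_
  obtain ⟨K, hK, hKU, hle⟩ := hlam.exists_isCompactSolid_le_add (Or.inl hU) hε
  calc (lam U : ℝ≥0∞) ≤ lam K + ε := by exact_mod_cast hle
    _ ≤ innerValue lam U + ε := by
      gcongr
      exact hlam.le_innerValue_of_isCompactSolid hK hKU

theorem extends_solidExtension : Extends (solidExtension lam) lam := by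
  rintro A (hA | hA)
  · rw [solidExtension_of_isOpen hA.1, hlam.innerValue_of_isBddOpenSolid hA]
  · refine le_antisymm (ENNReal.le_of_forall_pos_le_add fun ε hε _ => ?_)
      (le_iInf₂ fun U hU => hlam.le_innerValue_of_isCompactSolid hA hU.2)
    obtain ⟨U, hU, hAU, hle⟩ : ∃ U, IsBddOpenSolid U ∧ A ⊆ U ∧ lam U ≤ lam A + ε := by
      by_contra! hcon
      have hlb : lam A + ε ≤ lam A := (hlam.outer_regular A hA).2 (by
        rintro _ ⟨U, hU, hAU, rfl⟩
        exact (hcon U hU hAU).le)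
      exact (lt_add_of_pos_right (lam A) hε).not_ge hlb
    calc solidExtension lam A ≤ innerValue lam U := solidExtension_le hU.1 hAU
      _ = lam U := hlam.innerValue_of_isBddOpenSolid hU
      _ ≤ lam A + ε := by exact_mod_cast hle

theorem isCompactFinite_solidExtension : IsCompactFinite (solidExtension lam) := by
  intro K hK
  rcases K.eq_empty_or_nonempty with rfl | hne
  · rw [solidExtension_of_isOpen isOpen_empty, innerValue_empty]
    exact ENNReal.zero_lt_top
  · obtain ⟨E, hE, hKE⟩ := (isBoundedSet_of_isCompact hK).exists_isBddSolid hne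
    refine (solidExtension_mono hKE).trans_lt ?_
    rw [hlam.extends_solidExtension E hE]
    exact ENNReal.coe_lt_top

end IsSolidSetFunction

end Uniqueness

theorem theorem9 {X : Type*} [TopologicalSpace X] [T2Space X] [LocallyCompactSpace X]
    [PreconnectedSpace X] [LocallyConnectedSpace X]
    (lam : Set X → ℝ≥0) (hlam : IsSolidSetFunction lam) :
    ∃ μ : Set X → ℝ≥0∞,
      -- `μ` is a compact-finite topological measure that extends `lam`
      IsTopologicalMeasure μ ∧ IsCompactFinite μ ∧ Extends μ lam ∧
      -- and it is the only topological measure that does so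
      (∀ ν : Set X → ℝ≥0∞, IsTopologicalMeasure ν → Extends ν lam →
        ∀ A : Set X, IsOpen A ∨ IsClosed A → ν A = μ A) ∧
      -- first step (the subtraction that defines `lambdaOne` is a genuine one)
      (∀ A : Set X, IsBddSemisolidOrCompactConnected A →
        holesSum lam A ≤ (lam (solidHull A) : ℝ≥0∞) ∧ μ A = lambdaOne lam A) ∧
      -- second step
      (∀ (n : ℕ) (C : Fin n → Set X), (∀ i, IsCompact (C i) ∧ IsPreconnected (C i)) →
        Pairwise (Function.onFun Disjoint C) →
        lambdaTwo lam (⋃ i, C i) = ∑ i, lambdaOne lam (C i) ∧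
          μ (⋃ i, C i) = lambdaTwo lam (⋃ i, C i)) ∧
      -- third step
      (∀ U : Set X, IsOpen U → μ U = ⨆ K ∈ {K : Set X | IsKZero K ∧ K ⊆ U}, lambdaTwo lam K) ∧
      (∀ F : Set X, IsClosed F → μ F = ⨅ U ∈ {U : Set X | IsOpen U ∧ F ⊆ U}, μ U) := by
  have hμ := hlam.isTopologicalMeasure_solidExtension
  have hext := hlam.extends_solidExtension
  -- The explicit formulas of the first two steps are the uniqueness lemmas applied to the extension
  -- itself.
  refine ⟨solidExtension lam, hμ, hlam.isCompactFinite_solidExtension, hext,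
    fun ν hν hνe A hA => hν.eq_solidExtension hlam hνe hA,
    fun A hA => ⟨?_, hμ.eq_lambdaOne hlam hext hA⟩, fun n C hC hd => ?_, fun U hU => ?_,
    hμ.outer_regular⟩
  · rcases A.eq_empty_or_nonempty with rfl | hne
    · exact (solidHull_empty_eq hlam.apply_empty).ge
    · exact hlam.holesSum_le hA hne
  · obtain ⟨𝒞, h𝒞, hun, hsum⟩ := exists_isCompactFamily hC hd
    rw [hsum _ (lambdaOne_empty hlam.apply_empty), hun, h𝒞.lambdaTwo_sUnion]
    exact ⟨rfl, hμ.sUnion_isCompactFamily hlam hext h𝒞⟩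
  · rw [solidExtension_of_isOpen hU, innerValue_eq_iSup_lambdaTwo]
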